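/- **Setting.** Let $G_1\subseteq GL(n_1,\mathbb R)$ and $G_2\subseteq GL(n_2,\mathbb R)$ be matrix Lie groups (closed subgroups) of dimensions $N$ and $M$, each with a fixed basis $(E_i)$ of its Lie algebra. Write $x^\wedge=\sum_i x_iE_i$, let $\vee$ be the inverse of $\wedge$, and abbreviate $\exp(x)=\exp(x^\wedge)$. The left and right Jacobians $J_l(x),J_r(x)$ are the matrices with columns $(\partial_{x_i}g\,g^{-1})^\vee$ and $(g^{-1}\partial_{x_i}g)^\vee$ for $g=\exp(x)$. A *domain of exponential coordinates* is an open neighbourhood $D$ of $0$ on which $\exp$ is injective and $J_l$ is invertible; $\log^\vee$ denotes the inverse of $\exp:D\to\exp(D)$ (extended by $0$ outside $\exp(D)$). Let $D\subseteq\mathbb R^N$ and $D_2\subseteq\mathbb R^M$ be such domains for $G_1$ and $G_2$, and let $K\subseteq D$ be compact, convex and symmetric ($K=-K$). As usual for concentrated distributions on a group, the laws of the state in exponential coordinates are supported in $K$. **Posterior.** The prior is $g=\mu\exp(x)$, with $x\sim\mathcal N(0,P^-)$ supported in $K$ (i.e. conditioned on $K$). The observation is $g_z=k(g)\exp(r)$,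 with $k:G_1\to G_2$ and $r\sim\mathcal N(0,R)$, $R$ positive definite. By Bayes' formula the posterior law $\pi$ of $x$ given $g_z$ has density on $K$ proportional to $\mathcal N(x|0,P^-)\,\ell(x)$, where $\ell(x)=\mathcal N(r_x|0,R)/|\det J_r(r_x)|$ with $r_x=\log^\vee\big(k(\mu\exp x)^{-1}g_z\big)$, and $\ell(x)=0$ if $k(\mu\exp x)^{-1}g_z\notin\exp(D_2)$. The posterior $p(g|g_z)$ is the law of $\mu\exp(x)$ for $x\sim\pi$. **Gaussian filter.** Let $\tilde k(x,r)=\log^\vee[k(\mu)^{-1}k(\mu\exp x)\exp r]$. With expectations $\mathbb E$ under $\mathcal N(x|0,P^-)\,\mathcal N(r|0,R)$ put $$\tilde m=\mathbb E\,\tilde k,\quad S=\mathbb E(\tilde k-\tilde m)(\tilde k-\tilde m)^T,\quad C=\mathbb E\,x(\tilde k-\tilde m)^T,\quad K_g=CS^{-1},$$ $$m=K_g\big(\log^\vee(k(\mu)^{-1}g_z)-\tilde m\big),\qquad \Sigma=P^--K_gSK_g^T .$$ Assume that the problem is well posed: $\tilde k$ is square integrable, $S$ is invertible, $\ell$ is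 measurable on $K$, and the normalizing constant of $\pi$ is positive and finite. **Notation.** Let $\langle v(x)\rangle=\int_K v(x)\,\mathcal N(x|0,\Sigma)\,dx$, $\mathrm{sym}(A)=A+A^T$, and $m'=\langle J_l^{-1}\rangle^{-1}m$. Let $$\eta=\sup\Big\{\Big|\int f\,d\pi-\int f\,d\mathcal N(m,\Sigma)\Big| : f \text{ measurable},\ |f(x)|\le 1+\|x\|^2\Big\}$$ be the error (in weighted total variation) of replacing the posterior of $x$ by the Gaussian $\mathcal N(m,\Sigma)$. An element $a\in G_1$ is a *group-theoretic mean* of $p(g|g_z)$ if $\log^\vee(a^{-1}g)$ is almost surely defined, integrable, and has expectation $0$; the *covariance* about $a$ is the expectation of $\log^\vee(a^{-1}g)\log^\vee(a^{-1}g)^T$. **Theorem.** There are constants $c,\delta,\rho>0$, depending only on $G_1$, its basis, $D$ and $K$, such that for all $G_2,D_2,\mu,P^-,k,R,g_z$ as above with $\|m\|\le\delta$, $\|\Sigma\|_2\le\delta$ and $\eta\le\delta$ the following holds. The matrix $\langle J_l^{-1}\rangle$ is invertible; there is exactly one $\varepsilon\in\mathbb R^N$ with $\|\varepsilon\|\le\rho$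 for which $\mu_m=\mu\exp(\varepsilon)$ is a group-theoretic mean of the posterior $p(g|g_z)$; and, $\Sigma_m$ being the covariance of the posterior about $\mu_m$, $$\|\varepsilon-m'\|\le c\,(\|m'\|^2+\eta),\qquad \big\|\Sigma_m-\big(\Sigma-\mathrm{sym}\langle J_l^{-1}m'x^T\rangle\big)\big\|_2\le c\,(\|m'\|^2+\eta).$$ In other words, $\mu_m\approx\mu\exp\big(m'+O(\|m'\|^2)\big)$ and $\Sigma_m\approx\Sigma-\mathrm{sym}\langle J_l^{-1}m'x^T\rangle+O(\|m'\|^2)$, where $\approx$ is equality up to $O(\eta)$. -/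

import Mathlib

open MeasureTheory ProbabilityTheory Matrix
open scoped ENNReal

/-- The exponential coordinates `ℝ^N` with the Euclidean norm. -/
abbrev Coord (N : ℕ) : Type := EuclideanSpace ℝ (Fin N)

/-- An `N`-dimensional matrix Lie group: a closed subgroup of `GL(n, ℝ)` together with a basis
`E₁, …, E_N` of its Lie algebra `{X | exp (t X) ∈ G for all t}`. -/
structure MatrixLieGroup (n N : ℕ) where
  carrier : Subgroup (GL (Fin n) ℝ)
  closed : IsClosed (carrier : Set (GL (Fin n) ℝ))
  E : Fin N → Matrix (Fin n) (Fin n) ℝ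
  linInd : LinearIndependent ℝ E
  mem_span_iff : ∀ X : Matrix (Fin n) (Fin n) ℝ, X ∈ Submodule.span ℝ (Set.range E) ↔
    ∀ t : ℝ, ∃ g : carrier,
      ((g : GL (Fin n) ℝ) : Matrix (Fin n) (Fin n) ℝ) = NormedSpace.exp (t • X)

namespace MatrixLieGroup

variable {n N : ℕ} (G : MatrixLieGroup n N)

/-- `x^∧ = ∑ xᵢ Eᵢ`. -/
def hat (x : Coord N) : Matrix (Fin n) (Fin n) ℝ := ∑ i, x i • G.E i

open Classical in
/-- `X^∨`, the coordinates of an element `X` of the Lie algebra (and `0` for other matrices). -/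
noncomputable def vee (X : Matrix (Fin n) (Fin n) ℝ) : Coord N :=
  if h : X ∈ Submodule.span ℝ (Set.range G.E) then
    WithLp.toLp 2 (fun i => (Module.Basis.span G.linInd).repr ⟨X, h⟩ i)
  else 0

theorem hat_mem_span (x : Coord N) : G.hat x ∈ Submodule.span ℝ (Set.range G.E) :=
  Submodule.sum_mem _ fun i _ =>
    Submodule.smul_mem _ _ (Submodule.subset_span (Set.mem_range_self i))

theorem exists_exp (x : Coord N) : ∃ g : G.carrier,
    ((g : GL (Fin n) ℝ) : Matrix (Fin n) (Fin n) ℝ) = NormedSpace.exp (G.hat x) := by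
  have h := (G.mem_span_iff (G.hat x)).1 (G.hat_mem_span x) 1
  rwa [one_smul] at h

/-- `exp (x^∧)` as an element of the group. -/
noncomputable def exp (x : Coord N) : G.carrier := Classical.choose (G.exists_exp x)

theorem coe_exp (x : Coord N) :
    ((G.exp x : GL (Fin n) ℝ) : Matrix (Fin n) (Fin n) ℝ) = NormedSpace.exp (G.hat x) :=
  Classical.choose_spec (G.exists_exp x)

/-- The matrix `∂ exp(x^∧) / ∂ xᵢ`, entry by entry. -/
noncomputable def dexp (x : Coord N) (i : Fin N) : Matrix (Fin n) (Fin n) ℝ :=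
  Matrix.of fun a b =>
    deriv (fun t : ℝ => NormedSpace.exp (G.hat (x + t • EuclideanSpace.single i 1)) a b) 0

/-- The left Jacobian, with columns `(∂g/∂xᵢ g⁻¹)^∨` for `g = exp(x^∧)`. -/
noncomputable def Jl (x : Coord N) : Matrix (Fin N) (Fin N) ℝ :=
  Matrix.of fun j i => G.vee (G.dexp x i * NormedSpace.exp (-G.hat x)) j

/-- The right Jacobian, with columns `(g⁻¹ ∂g/∂xᵢ)^∨` for `g = exp(x^∧)`. -/
noncomputable def Jr (x : Coord N) : Matrix (Fin N) (Fin N) ℝ :=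
  Matrix.of fun j i => G.vee (NormedSpace.exp (-G.hat x) * G.dexp x i) j

/-- `D` is a domain of exponential coordinates: an open neighbourhood of the origin which `exp`
maps injectively, and with invertible Jacobian, to the group. -/
structure IsExpDomain (D : Set (Coord N)) : Prop where
  isOpen : IsOpen D
  zero_mem : 0 ∈ D
  injOn : Set.InjOn G.exp D
  det_ne_zero : ∀ x ∈ D, (G.Jl x).det ≠ 0

open Classical in
/-- `log^∨`, the inverse of `exp : D → exp(D)`, extended by `0` outside `exp(D)`. -/
noncomputable def log (D : Set (Coord N)) (g : G.carrier) : Coord N :=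
  if h : ∃ x ∈ D, G.exp x = g then Classical.choose h else 0

/-- `a` is a group-theoretic mean of the law of `g = μ exp(x)`, where `x` has law `p`:
`log^∨(a⁻¹ g)` is almost surely defined and integrable, and its expectation is `0`. -/
def IsGroupMean (D : Set (Coord N)) (μ : G.carrier) (p : Measure (Coord N))
    (a : G.carrier) : Prop :=
  (∀ᵐ x ∂p, a⁻¹ * (μ * G.exp x) ∈ G.exp '' D) ∧
  Integrable (fun x => G.log D (a⁻¹ * (μ * G.exp x))) p ∧
  ∫ x, G.log D (a⁻¹ * (μ * G.exp x)) ∂p = 0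

/-- The covariance about `a` of the law of `g = μ exp(x)`, where `x` has law `p`:
the expectation of `log^∨(a⁻¹ g) log^∨(a⁻¹ g)ᵀ`. -/
noncomputable def groupCov (D : Set (Coord N)) (μ : G.carrier) (p : Measure (Coord N))
    (a : G.carrier) : Matrix (Fin N) (Fin N) ℝ :=
  Matrix.of fun i j =>
    ∫ x, G.log D (a⁻¹ * (μ * G.exp x)) i * G.log D (a⁻¹ * (μ * G.exp x)) j ∂p

/-- `⟨J_l⁻¹⟩`, the average over `x ∈ K` under the Gaussian `N(0, Σ)`. -/
noncomputable def avgJlInv (K : Set (Coord N)) (cov : Matrix (Fin N) (Fin N) ℝ) :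
    Matrix (Fin N) (Fin N) ℝ :=
  Matrix.of fun i j => ∫ x in K, (G.Jl x)⁻¹ i j ∂(multivariateGaussian 0 cov)

/-- `⟨J_l⁻¹ v xᵀ⟩`, the average over `x ∈ K` under the Gaussian `N(0, Σ)`. -/
noncomputable def avgJlInvMul (K : Set (Coord N)) (cov : Matrix (Fin N) (Fin N) ℝ)
    (v : Coord N) : Matrix (Fin N) (Fin N) ℝ :=
  Matrix.of fun i j =>
    ∫ x in K, ((G.Jl x)⁻¹ *ᵥ v.ofLp) i * x j ∂(multivariateGaussian 0 cov)

/-- The corrected vector `m' = ⟨J_l⁻¹⟩⁻¹ m`. -/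
noncomputable def corrected (K : Set (Coord N)) (cov : Matrix (Fin N) (Fin N) ℝ)
    (m : Coord N) : Coord N :=
  WithLp.toLp 2 ((G.avgJlInv K cov)⁻¹ *ᵥ m.ofLp)

end MatrixLieGroup

/-- `sym(A) = A + Aᵀ`. -/
def symPart {N : ℕ} (A : Matrix (Fin N) (Fin N) ℝ) : Matrix (Fin N) (Fin N) ℝ := A + Aᵀ

/-- The spectral norm `‖A‖₂`. -/
noncomputable def spectralNorm₂ {N : ℕ} (A : Matrix (Fin N) (Fin N) ℝ) : ℝ :=
  ‖Matrix.toEuclideanCLM (n := Fin N) (𝕜 := ℝ) A‖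

/-- The density `N(r | 0, R)` with respect to Lebesgue measure. -/
noncomputable def gaussianDensity {M : ℕ} (R : Matrix (Fin M) (Fin M) ℝ) (r : Coord M) : ℝ :=
  (Real.sqrt ((2 * Real.pi) ^ M * R.det))⁻¹ *
    Real.exp (-(1 / 2) * (r.ofLp ⬝ᵥ (R⁻¹ *ᵥ r.ofLp)))

/-- The total variation distance of two laws on `ℝ^N`, weighted by `1 + ‖x‖²`: the supremum of
`|∫ f dp - ∫ f dq|` over all measurable `f` with `|f x| ≤ 1 + ‖x‖²`. -/
noncomputable def weightedTV {N : ℕ} (p q : Measure (Coord N)) : ℝ≥0∞ :=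
  ⨆ f : {f : Coord N → ℝ // Measurable f ∧ ∀ x, |f x| ≤ 1 + ‖x‖ ^ 2},
    ENNReal.ofReal |∫ x, f.1 x ∂p - ∫ x, f.1 x ∂q|

/-- The data of the fusion problem: the prior `g = μ exp(x)`, `x ∼ N(0, P)`, the observation model
`g_z = k(g) exp(r)`, `r ∼ N(0, R)`, the domain of `log^∨` on the observation group, and the
value `g_z` observed. -/
structure FusionProblem {n₁ N n₂ M : ℕ} (G₁ : MatrixLieGroup n₁ N)
    (G₂ : MatrixLieGroup n₂ M) where
  μ : G₁.carrier
  P : Matrix (Fin N) (Fin N) ℝ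
  P_posSemidef : P.PosSemidef
  k : G₁.carrier → G₂.carrier
  R : Matrix (Fin M) (Fin M) ℝ
  R_posDef : R.PosDef
  D₂ : Set (Coord M)
  isExpDomain : G₂.IsExpDomain D₂
  gz : G₂.carrier

namespace FusionProblem

variable {n₁ N n₂ M : ℕ} {G₁ : MatrixLieGroup n₁ N} {G₂ : MatrixLieGroup n₂ M}
  (F : FusionProblem G₁ G₂)

/-- `k̃(x, r) = log^∨(k(μ)⁻¹ k(μ exp x) exp r)`. -/
noncomputable def kTilde (w : Coord N × Coord M) : Coord M :=
  G₂.log F.D₂ ((F.k F.μ)⁻¹ * F.k (F.μ * G₁.exp w.1) * G₂.exp w.2)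

/-- The joint law `N(0, P) ⊗ N(0, R)` of `(x, r)`. -/
noncomputable def joint : Measure (Coord N × Coord M) :=
  (multivariateGaussian 0 F.P).prod (multivariateGaussian 0 F.R)

/-- `m̃ = ⟨k̃⟩`. -/
noncomputable def mTilde : Coord M := ∫ w, F.kTilde w ∂F.joint

/-- `S = ⟨(k̃ - m̃)(k̃ - m̃)ᵀ⟩`. -/
noncomputable def S : Matrix (Fin M) (Fin M) ℝ :=
  Matrix.of fun i j =>
    ∫ w, (F.kTilde w - F.mTilde) i * (F.kTilde w - F.mTilde) j ∂F.joint

/-- `C = ⟨x (k̃ - m̃)ᵀ⟩`. -/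
noncomputable def C : Matrix (Fin N) (Fin M) ℝ :=
  Matrix.of fun i j => ∫ w, w.1 i * (F.kTilde w - F.mTilde) j ∂F.joint

/-- The gain `K = C S⁻¹`. -/
noncomputable def gain : Matrix (Fin N) (Fin M) ℝ := F.C * F.S⁻¹

/-- The Gaussian-filter posterior mean `m = K (log^∨(k(μ)⁻¹ g_z) - m̃)`. -/
noncomputable def m : Coord N :=
  WithLp.toLp 2 (F.gain *ᵥ (G₂.log F.D₂ ((F.k F.μ)⁻¹ * F.gz) - F.mTilde).ofLp)

/-- The Gaussian-filter posterior covariance `Σ = P - K S Kᵀ`. -/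
noncomputable def cov : Matrix (Fin N) (Fin N) ℝ := F.P - F.gain * F.S * F.gainᵀ

open Classical in
/-- The likelihood `p(g_z | g = μ exp x)`: the density of `k(g) exp(r)` at `g_z` with respect to
the Haar measure `|det J_r(r)| dr`, namely `N(r | 0, R) / |det J_r(r)|` at
`r = log^∨(k(g)⁻¹ g_z)`. -/
noncomputable def likelihood (x : Coord N) : ℝ :=
  if (F.k (F.μ * G₁.exp x))⁻¹ * F.gz ∈ G₂.exp '' F.D₂ then
    gaussianDensity F.R (G₂.log F.D₂ ((F.k (F.μ * G₁.exp x))⁻¹ * F.gz)) /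
      |(G₂.Jr (G₂.log F.D₂ ((F.k (F.μ * G₁.exp x))⁻¹ * F.gz))).det|
  else 0

/-- The normalizing constant of Bayes' formula, for the prior `N(0, P)` supported in `K`. -/
noncomputable def evidence (K : Set (Coord N)) : ℝ≥0∞ :=
  ∫⁻ x in K, ENNReal.ofReal (F.likelihood x) ∂(multivariateGaussian 0 F.P)

/-- The posterior law of `x` given `g_z`, by Bayes' formula, for the prior `N(0, P)` supported
in `K`. The posterior `p(g | g_z)` is the law of `μ exp(x)`. -/
noncomputable def posterior (K : Set (Coord N)) : Measure (Coord N) :=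
  (F.evidence K)⁻¹ • ((multivariateGaussian 0 F.P).restrict K).withDensity
    (fun x => ENNReal.ofReal (F.likelihood x))

/-- The Bayesian problem is well posed: the moments in the Gaussian filter exist, `S` is
invertible, and the posterior is well defined. -/
structure WellPosed (K : Set (Coord N)) : Prop where
  memLp : MemLp F.kTilde 2 F.joint
  isUnit_S : IsUnit F.S.det
  aemeasurable : AEMeasurable F.likelihood ((multivariateGaussian 0 F.P).restrict K)
  evidence_ne_zero : F.evidence K ≠ 0
  evidence_ne_top : F.evidence K ≠ ∞

/-- The error of the approximation of the posterior of `x` by the Gaussian `N(m, Σ)`. -/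
noncomputable def gaussError (K : Set (Coord N)) : ℝ≥0∞ :=
  weightedTV (F.posterior K) (multivariateGaussian F.m F.cov)

end FusionProblem

/-!
The posterior law of `x` is a probability measure `p` supported in `K`, at weighted distance `η`
from the Gaussian `N(m, Σ)`. Writing `h(ε, x) = log^∨(exp(-ε) exp(x))`, the element `μ exp(ε)` is a
group-theoretic mean exactly when `∫ h(ε, x) dp = 0`, and the covariance about it is
`∫ h(ε, x) h(ε, x)ᵀ dp`. Everything follows from the expansion `h(ε, x) ≈ x - J_l(x)⁻¹ ε`.

*The expansion.* The solution of `y' = -J_l(y)⁻¹ ε`, `y(0) = x`, satisfies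
`exp(t ε) exp(y(t)) = exp(x)`, so `y(1) = h(ε, x)`. This shows, without any appeal to the topology
of the group, that `exp(-ε) exp(x)` stays in `exp(D)` for `x ∈ K` and small `ε`. Comparing two such
solutions gives `h(ε, x) - h(ε', x) = -J_l(x)⁻¹ (ε - ε') + O(s ‖ε - ε'‖)` for `‖ε‖, ‖ε'‖ ≤ s`,
uniformly in `x ∈ K` (`norm_flow_sub_flow_le`, `MatrixLieGroup.exists_isTranslationChart`).

*From the posterior to the centred Gaussian.* The matrix `Σ` is positive semidefinite, being the
covariance of `x - K_g (k̃ - m̃)`. The Gaussian `N(m, Σ)` has mass at most `η` outside `K`. For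
`X ∼ N(0, Σ)`, both `X + m` and `X - m` lie in `K` with probability at least `1 - 2η`, by the
symmetry of `K`, and then so does `X`, by convexity. Hence the integral of a bounded Lipschitz
function on `K` changes by `O(‖m‖ + η)` when `p` is replaced by the restriction of `N(0, Σ)` to `K`
(`IsNearGaussian.abs_integral_sub_setIntegral_le`).

*The mean.* As `J_l(0) = 1` and `Σ` is small, `⟨J_l⁻¹⟩` and `∫ J_l⁻¹ dp` are close to `1`. So
`ε ↦ ε + ∫ h(ε, x) dp` is a contraction of a small ball, whose fixed point is the mean. There
`0 = m - ⟨J_l⁻¹⟩ ε + O(η + (‖m‖ + η) ‖ε‖ + ‖ε‖²)`, and `ε = m' + O(‖m'‖² + η)`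
(`IsNearGaussian.norm_sub_corrected_le`).

*The covariance.* Expanding `h hᵀ` to first order in `ε` gives `∫ x xᵀ dp = Σ + m mᵀ + O(η)` minus
`sym ∫ J_l⁻¹ ε xᵀ dp`, in which `ε` may be replaced by `m'` and `p` by the centred Gaussian
(`IsNearGaussian.abs_covariance_sub_le`).
-/

/-! ### Flows of left translations -/

section Flow

variable {E : Type*} [NormedAddCommGroup E] [NormedSpace ℝ E]

/-- The Picard-Lindelöf theorem for the autonomous vector fields `y ↦ -V(y) ε`, with control of the
solution up to time `1`. -/
theorem exists_flow [CompleteSpace E] {V : E → E →L[ℝ] E} {x ε : E} {B L : NNReal}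
    (hB : ∀ y ∈ Metric.closedBall x (B * ‖ε‖), ‖V y‖ ≤ B)
    (hL : LipschitzOnWith L V (Metric.closedBall x (B * ‖ε‖))) :
    ∃ y : ℝ → E, y 0 = x ∧ (∀ t, y t ∈ Metric.closedBall x (B * ‖ε‖)) ∧
      ∀ t ∈ Set.Icc (0 : ℝ) 1, HasDerivWithinAt y (-(V (y t) ε)) (Set.Icc 0 1) t := by
  have hf : IsPicardLindelof (fun _ y => -(V y ε)) (tmin := 0) (tmax := 1)
      ⟨0, by simp⟩ x (B * ‖ε‖₊) 0 (B * ‖ε‖₊) (L * ‖ε‖₊) := by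
    refine ⟨fun _ _ => ?_, fun _ _ => continuousOn_const, fun _ _ y hy => ?_, by simp⟩
    · refine LipschitzOnWith.of_dist_le_mul fun y hy z hz => ?_
      rw [dist_neg_neg, dist_eq_norm, ← _root_.sub_apply]
      refine (ContinuousLinearMap.le_opNorm _ _).trans ?_
      have := hL.dist_le_mul y hy z hz
      rw [dist_eq_norm] at this
      push_cast
      calc _ ≤ (L * dist y z) * ‖ε‖ := by gcongr
        _ = _ := by ring
    · rw [norm_neg]
      exact (ContinuousLinearMap.le_opNorm _ _).trans
        (mul_le_mul_of_nonneg_right (hB y hy) (norm_nonneg _))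
  have hx : x ∈ Metric.closedBall x ((0 : NNReal) : ℝ) := by simp
  obtain ⟨α, hα⟩ := ODE.FunSpace.exists_isFixedPt_next hf hx
  refine ⟨α.compProj, ?_, fun t => α.compProj_mem_closedBall hf.mul_max_le, fun t ht => ?_⟩
  · have := α.compProj_val (t := ⟨0, by simp⟩)
    rw [← hα, ODE.FunSpace.next_apply₀, hα] at this
    exact this
  · refine (ODE.hasDerivWithinAt_picard_Icc (t₀ := 0) (by simp) hf.continuousOn_uncurry
      α.continuous_compProj.continuousOn (fun _ _ => α.compProj_mem_closedBall hf.mul_max_le)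
      x ht).congr_of_mem (fun t' ht' => ?_) ht
    nth_rw 1 [← hα]
    rw [ODE.FunSpace.compProj_of_mem ht', ODE.FunSpace.next_apply]

/-- Two solutions of `y' = -V(y) ε` with the same initial value but different `ε` differ at time
`1` by the linearized difference, up to a second-order error. -/
theorem norm_flow_sub_flow_le {V : E → E →L[ℝ] E} {S : Set E} {x ε ε' : E} {B L s : ℝ}
    (hB0 : 0 ≤ B) (hL0 : 0 ≤ L)
    (hB : ∀ y ∈ S, ‖V y‖ ≤ B) (hL : ∀ y ∈ S, ∀ z ∈ S, ‖V y - V z‖ ≤ L * ‖y - z‖) (hxS : x ∈ S)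
    (hε : ‖ε‖ ≤ s) (hε' : ‖ε'‖ ≤ s) (hs : L * s ≤ 1 / 2) {y z : ℝ → E}
    (hy0 : y 0 = x) (hz0 : z 0 = x) (hyS : ∀ t, y t ∈ S) (hzS : ∀ t, z t ∈ S)
    (hyx : ∀ t, ‖y t - x‖ ≤ B * s)
    (hy : ∀ t ∈ Set.Icc (0 : ℝ) 1, HasDerivWithinAt y (-(V (y t) ε)) (Set.Icc 0 1) t)
    (hz : ∀ t ∈ Set.Icc (0 : ℝ) 1, HasDerivWithinAt z (-(V (z t) ε')) (Set.Icc 0 1) t) :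
    ‖y 1 - z 1 + V x (ε - ε')‖ ≤ 3 * L * B * s * ‖ε - ε'‖ := by
  have hs0 : 0 ≤ s := (norm_nonneg _).trans hε
  have hcont : ContinuousOn (fun t => ‖y t - z t‖) (Set.Icc (0 : ℝ) 1) :=
    ((HasDerivWithinAt.continuousOn hy).sub (HasDerivWithinAt.continuousOn hz)).norm
  obtain ⟨t₀, ht₀, hmax⟩ := isCompact_Icc.exists_isMaxOn (Set.nonempty_Icc.2 zero_le_one) hcont
  have hsplit : ∀ t, -(V (y t) ε) - -(V (z t) ε') =
      -(V (y t) (ε - ε')) - (V (y t) - V (z t)) ε' := by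
    intro t; simp only [map_sub, _root_.sub_apply]; abel
  -- the maximal distance of the two solutions is absorbed, because `L * s ≤ 1 / 2`
  have hM : ‖y t₀ - z t₀‖ ≤ 2 * B * ‖ε - ε'‖ := by
    have h := Convex.norm_image_sub_le_of_norm_hasDerivWithin_le
      (f := fun t => y t - z t) (f' := fun t => -(V (y t) ε) - -(V (z t) ε'))
      (C := B * ‖ε - ε'‖ + (1 / 2) * ‖y t₀ - z t₀‖)
      (fun t ht => (hy t ht).sub (hz t ht)) (fun t ht => ?_) (convex_Icc (0 : ℝ) 1)
      (Set.left_mem_Icc.2 zero_le_one) ht₀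
    · simp only [hy0, hz0, sub_self, sub_zero, Real.norm_eq_abs, abs_of_nonneg ht₀.1] at h
      have h0 : 0 ≤ B * ‖ε - ε'‖ + (1 / 2) * ‖y t₀ - z t₀‖ := by positivity
      nlinarith [mul_le_mul_of_nonneg_left ht₀.2 h0]
    · rw [hsplit]
      have h1 := (V (y t)).le_of_opNorm_le (hB _ (hyS t)) (ε - ε')
      have h2 : ‖V (y t) - V (z t)‖ ≤ L * ‖y t₀ - z t₀‖ :=
        (hL _ (hyS t) _ (hzS t)).trans (mul_le_mul_of_nonneg_left (hmax ht) hL0)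
      have h3 := (V (y t) - V (z t)).le_of_opNorm_le h2 ε'
      have h4 : L * ‖y t₀ - z t₀‖ * ‖ε'‖ ≤ (1 / 2) * ‖y t₀ - z t₀‖ := by
        nlinarith [mul_le_mul_of_nonneg_left hε' (mul_nonneg hL0 (norm_nonneg (y t₀ - z t₀))),
          norm_nonneg (y t₀ - z t₀)]
      refine (norm_sub_le _ _).trans ?_
      rw [norm_neg]
      linarith
  have h := norm_image_sub_le_of_norm_deriv_le_segment_01'
    (f := fun t => y t - z t + t • V x (ε - ε'))
    (f' := fun t => -(V (y t) ε) - -(V (z t) ε') + (1 : ℝ) • V x (ε - ε'))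
    (C := 3 * L * B * s * ‖ε - ε'‖)
    (fun t ht => ((hy t ht).sub (hz t ht)).add ((hasDerivWithinAt_id t _).smul_const _))
    (fun t ht => ?_)
  · simpa [hy0, hz0] using h
  · have heq : -(V (y t) ε) - -(V (z t) ε') + (1 : ℝ) • V x (ε - ε') =
        -((V (y t) - V x) (ε - ε')) - (V (y t) - V (z t)) ε' := by
      rw [hsplit, one_smul]; simp only [_root_.sub_apply]; abel
    rw [heq]
    have h1 := (V (y t) - V x).le_of_opNorm_le
      ((hL _ (hyS t) _ hxS).trans (mul_le_mul_of_nonneg_left (hyx t) hL0)) (ε - ε')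
    have h2 : ‖V (y t) - V (z t)‖ ≤ L * (2 * B * ‖ε - ε'‖) :=
      (hL _ (hyS t) _ (hzS t)).trans
        (mul_le_mul_of_nonneg_left ((hmax (Set.Ico_subset_Icc_self ht)).trans hM) hL0)
    have h3 := ((V (y t) - V (z t)).le_of_opNorm_le h2 ε').trans
      (mul_le_mul_of_nonneg_left hε' (by positivity))
    refine (norm_sub_le _ _).trans ?_
    rw [norm_neg]
    linarith

end Flow

/-! ### The derivative of the exponential of a linear map -/

section ExpDeriv

variable {E A : Type*} [NormedAddCommGroup E] [NormedSpace ℝ E] [FiniteDimensional ℝ E]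
  [NormedRing A] [NormedAlgebra ℝ A] [FiniteDimensional ℝ A] (φ : E →ₗ[ℝ] A) (w : A →ₗ[ℝ] E)

/-- The derivative at `x` of `y ↦ exp (φ y)`. It is a plain linear map, so that no topology on `A`
enters its type: on matrices the product topology and the topology of a norm are equal, but not
syntactically so. -/
noncomputable def expDeriv (x : E) : E →ₗ[ℝ] A := fderiv ℝ (fun y => NormedSpace.exp (φ y)) x

theorem contDiff_exp_comp : ContDiff ℝ 2 fun y => NormedSpace.exp (φ y) := by
  have : CompleteSpace A := FiniteDimensional.complete ℝ A
  exact (contDiff_iff_contDiffAt.2 fun X : A =>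
    (NormedSpace.exp_analytic (𝕂 := ℝ) X).contDiffAt).comp
      (LinearMap.toContinuousLinearMap φ).contDiff

theorem hasFDerivAt_exp_comp (x : E) : HasFDerivAt (fun y => NormedSpace.exp (φ y))
    (LinearMap.toContinuousLinearMap (expDeriv φ x)) x :=
  ((contDiff_exp_comp φ).differentiable (by norm_num) x).hasFDerivAt

theorem deriv_linearMap_exp (ℓ : A →ₗ[ℝ] ℝ) (x v : E) :
    deriv (fun t : ℝ => ℓ (NormedSpace.exp (φ (x + t • v)))) 0 = ℓ (expDeriv φ x v) := by
  have h1 : HasDerivAt (fun t : ℝ => x + t • v) v 0 := by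
    simpa using ((hasDerivAt_id (0 : ℝ)).smul_const v).const_add x
  have h2 := hasFDerivAt_exp_comp φ (x + (0 : ℝ) • v)
  rw [zero_smul, add_zero] at h2
  have h3 := (LinearMap.toContinuousLinearMap ℓ).hasFDerivAt.comp_hasDerivAt (0 : ℝ)
    (HasFDerivAt.comp_hasDerivAt (0 : ℝ) (by simpa using h2) h1)
  exact h3.deriv

/-- The logarithmic derivative `v ↦ w (d exp_x (v) exp(-x))`, for a linear map `w` from the algebra
back to the coordinates. -/
noncomputable def expJac (x : E) : E →L[ℝ] E :=
  LinearMap.toContinuousLinearMap w ∘L ((ContinuousLinearMap.mul ℝ A).flip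
    (NormedSpace.exp (-φ x))) ∘L LinearMap.toContinuousLinearMap (expDeriv φ x)

theorem contDiff_expJac : ContDiff ℝ 1 (expJac φ w) := by
  have h1 : ContDiff ℝ 1 (fun x => LinearMap.toContinuousLinearMap (expDeriv φ x)) :=
    (contDiff_exp_comp φ).fderiv_right (by norm_num)
  have h2 : ContDiff ℝ 1 fun x : E => NormedSpace.exp (-φ x) := by
    simp_rw [← map_neg]
    exact ((contDiff_exp_comp φ).of_le (by norm_num)).comp contDiff_neg
  exact contDiff_const.clm_comp
    (((ContinuousLinearMap.mul ℝ A).flip.contDiff.comp h2).clm_comp h1)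

theorem expDeriv_zero : expDeriv φ 0 = φ := by
  have : CompleteSpace A := FiniteDimensional.complete ℝ A
  have h1 : HasFDerivAt (fun y => NormedSpace.exp (φ y))
      ((1 : A →L[ℝ] A) ∘L LinearMap.toContinuousLinearMap φ) 0 := by
    refine HasFDerivAt.comp (0 : E) ?_ (LinearMap.toContinuousLinearMap φ).hasFDerivAt
    rw [map_zero]
    exact hasFDerivAt_exp_zero
  rw [expDeriv, h1.fderiv]
  rfl

/-- If `d exp_{y(t)} (y'(t)) = -φ(ε) exp(y(t))`, the product `exp(t ε) exp(y(t))` is constant. -/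
theorem exp_mul_exp_flow {ε : E} {y y' : ℝ → E}
    (hy : ∀ t ∈ Set.Icc (0 : ℝ) 1, HasDerivWithinAt y (y' t) (Set.Icc 0 1) t)
    (hy' : ∀ t, expDeriv φ (y t) (y' t) = -φ ε * NormedSpace.exp (φ (y t))) :
    NormedSpace.exp (φ ε) * NormedSpace.exp (φ (y 1)) = NormedSpace.exp (φ (y 0)) := by
  have : CompleteSpace A := FiniteDimensional.complete ℝ A
  have h : ∀ t ∈ Set.Icc (0 : ℝ) 1, HasDerivWithinAt
      (fun t : ℝ => NormedSpace.exp (t • φ ε) * NormedSpace.exp (φ (y t))) 0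
      (Set.Icc 0 1) t := by
    intro t ht
    have h1 := (hasDerivAt_exp_smul_const (𝕂 := ℝ) (φ ε) t).hasDerivWithinAt
      (s := Set.Icc (0 : ℝ) 1)
    have h2 := (hasFDerivAt_exp_comp φ (y t)).comp_hasDerivWithinAt t (hy t ht)
    refine (h1.mul h2).congr_deriv ?_
    rw [LinearMap.coe_toContinuousLinearMap', hy', neg_mul, mul_neg, ← mul_assoc,
      Function.comp_apply, add_neg_cancel]
  have h1 := norm_image_sub_le_of_norm_deriv_le_segment_01' (C := 0) h (fun t _ => by simp)
  rw [norm_le_zero_iff, sub_eq_zero] at h1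
  simpa using h1

end ExpDeriv

/-! ### The Jacobian of the exponential map -/

namespace MatrixLieGroup

open scoped Matrix.Norms.Operator

variable {n N : ℕ} (G : MatrixLieGroup n N)

/-- `hat` as a linear map. -/
noncomputable def hatL : Coord N →ₗ[ℝ] Matrix (Fin n) (Fin n) ℝ where
  toFun := G.hat
  map_add' x y := by simp [hat, add_smul, Finset.sum_add_distrib]
  map_smul' c x := by simp [hat, Finset.smul_sum, smul_smul]

@[simp] theorem hatL_apply (x : Coord N) : G.hatL x = G.hat x := rfl

theorem vee_hat (x : Coord N) : G.vee (G.hat x) = x := by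
  ext i
  have h : (⟨G.hat x, G.hat_mem_span x⟩ : Submodule.span ℝ (Set.range G.E)) =
      ∑ i, x i • (Module.Basis.span G.linInd) i := by
    ext1
    simp [hat, Module.Basis.span_apply]
  rw [vee, dif_pos (G.hat_mem_span x)]
  simp only [h, Module.Basis.repr_sum_self]

theorem hat_vee {X : Matrix (Fin n) (Fin n) ℝ} (hX : X ∈ Submodule.span ℝ (Set.range G.E)) :
    G.hat (G.vee X) = X := by
  rw [vee, dif_pos hX, hat]
  have h := congrArg Subtype.val ((Module.Basis.span G.linInd).sum_repr ⟨X, hX⟩)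
  simpa [Module.Basis.span_apply] using h

theorem ker_hatL : LinearMap.ker G.hatL = ⊥ := by
  refine LinearMap.ker_eq_bot.2 fun x y hxy => ?_
  rw [← G.vee_hat x, ← G.vee_hat y]
  exact congrArg G.vee hxy

/-- A linear left inverse of `hat` on the space of all matrices. It agrees with `vee` on the Lie
algebra; `vee` itself is not linear, being `0` outside the Lie algebra. -/
noncomputable def veeL : Matrix (Fin n) (Fin n) ℝ →ₗ[ℝ] Coord N :=
  Classical.choose (LinearMap.exists_leftInverse_of_injective _ G.ker_hatL)

theorem veeL_hat (x : Coord N) : G.veeL (G.hat x) = x :=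
  LinearMap.congr_fun
    (Classical.choose_spec (LinearMap.exists_leftInverse_of_injective _ G.ker_hatL)) x

theorem veeL_eq_vee {X : Matrix (Fin n) (Fin n) ℝ}
    (hX : X ∈ Submodule.span ℝ (Set.range G.E)) : G.veeL X = G.vee X := by
  rw [← G.hat_vee hX, veeL_hat, vee_hat]

theorem exp_neg_mul_exp (x : Coord N) :
    NormedSpace.exp (-G.hat x) * NormedSpace.exp (G.hat x) = 1 := by
  rw [← Matrix.exp_add_of_commute (-G.hat x) (G.hat x) (Commute.refl (G.hat x)).neg_left,
    neg_add_cancel, NormedSpace.exp_zero]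

theorem dexp_eq_expDeriv (x : Coord N) (i : Fin N) :
    G.dexp x i = expDeriv G.hatL x (EuclideanSpace.single i 1) := by
  ext a b
  exact deriv_linearMap_exp G.hatL (Matrix.entryLinearMap ℝ ℝ a b) x (EuclideanSpace.single i 1)

/-- The left Jacobian as an operator, with the linear `veeL` in place of `vee`, so that it is
smooth everywhere. -/
noncomputable def jacL (x : Coord N) : Coord N →L[ℝ] Coord N := expJac G.hatL G.veeL x

theorem jacL_apply (x v : Coord N) :
    G.jacL x v = G.veeL (expDeriv G.hatL x v * NormedSpace.exp (-G.hat x)) := rfl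

theorem contDiff_jacL : ContDiff ℝ 1 G.jacL := contDiff_expJac G.hatL G.veeL

/-- The inverse left Jacobian as an operator on the Euclidean space. -/
noncomputable def jlInv (x : Coord N) : Coord N →L[ℝ] Coord N :=
  Matrix.toEuclideanCLM (n := Fin N) (𝕜 := ℝ) (G.Jl x)⁻¹

section ExpDomain

variable {G}
variable {x : Coord N} (hx : (G.Jl x).det ≠ 0)
include hx

/-- Since `vee` vanishes outside the Lie algebra, an invertible left Jacobian forces the
logarithmic derivatives of `exp` to lie in the Lie algebra. -/
theorem dexp_mul_exp_neg_mem (i : Fin N) :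
    G.dexp x i * NormedSpace.exp (-G.hat x) ∈ Submodule.span ℝ (Set.range G.E) := by
  by_contra h
  refine hx (Matrix.det_eq_zero_of_column_eq_zero i fun j => ?_)
  simp [Jl, vee, h]

theorem expDeriv_mul_exp_neg_mem (v : Coord N) :
    expDeriv G.hatL x v * NormedSpace.exp (-G.hat x) ∈ Submodule.span ℝ (Set.range G.E) := by
  rw [← (EuclideanSpace.basisFun (Fin N) ℝ).sum_repr v, map_sum, Finset.sum_mul]
  refine Submodule.sum_mem _ fun i _ => ?_
  rw [map_smul, smul_mul_assoc, EuclideanSpace.basisFun_apply, ← dexp_eq_expDeriv]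
  exact Submodule.smul_mem _ _ (dexp_mul_exp_neg_mem hx i)

theorem jacL_eq : G.jacL x = Matrix.toEuclideanCLM (n := Fin N) (𝕜 := ℝ) (G.Jl x) := by
  refine ContinuousLinearMap.coe_injective
    ((EuclideanSpace.basisFun (Fin N) ℝ).toBasis.ext fun i => ?_)
  ext j
  simp only [OrthonormalBasis.coe_toBasis, EuclideanSpace.basisFun_apply,
    ContinuousLinearMap.coe_coe, jacL_apply, ← dexp_eq_expDeriv]
  rw [G.veeL_eq_vee (dexp_mul_exp_neg_mem hx i)]
  simp [Jl]

/-- `d exp_x (v) = (J_l(x) v)^∧ exp(x)`. -/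
theorem expDeriv_apply (v : Coord N) :
    expDeriv G.hatL x v = G.hat (G.jacL x v) * NormedSpace.exp (G.hat x) := by
  rw [jacL_apply, G.veeL_eq_vee (expDeriv_mul_exp_neg_mem hx v),
    G.hat_vee (expDeriv_mul_exp_neg_mem hx v), mul_assoc, exp_neg_mul_exp, mul_one]

theorem jacL_mul_jlInv : G.jacL x * G.jlInv x = 1 := by
  rw [jacL_eq hx, jlInv, ← map_mul, Matrix.mul_nonsing_inv _ (isUnit_iff_ne_zero.2 hx), map_one]

theorem jlInv_mul_jacL : G.jlInv x * G.jacL x = 1 := by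
  rw [jacL_eq hx, jlInv, ← map_mul, Matrix.nonsing_inv_mul _ (isUnit_iff_ne_zero.2 hx), map_one]

theorem jacL_jlInv (v : Coord N) : G.jacL x (G.jlInv x v) = v := by
  rw [← mul_apply_eq_comp, jacL_mul_jlInv hx]
  rfl

theorem isUnit_jacL : IsUnit (G.jacL x) :=
  isUnit_iff_exists.2 ⟨G.jlInv x, jacL_mul_jlInv hx, jlInv_mul_jacL hx⟩

/-- The operator form of `J_l⁻¹` through the smooth `jacL`, from which its smoothness is read off. -/
theorem jlInv_eq_inverse : G.jlInv x = Ring.inverse (G.jacL x) := by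
  rw [← mul_one (G.jlInv x), ← Ring.mul_inverse_cancel _ (isUnit_jacL hx), ← mul_assoc,
    jlInv_mul_jacL hx, one_mul]

end ExpDomain

variable {G} {D : Set (Coord N)} (hD : G.IsExpDomain D)
include hD

theorem contDiffAt_jlInv {x : Coord N} (hx : x ∈ D) : ContDiffAt ℝ 1 G.jlInv x := by
  obtain ⟨u, h1⟩ := isUnit_jacL (hD.det_ne_zero x hx)
  have h : ContDiffAt ℝ 1 (fun y => Ring.inverse (G.jacL y)) x := by
    refine ContDiffAt.comp (g := Ring.inverse) x ?_ G.contDiff_jacL.contDiffAt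
    rw [← h1]
    exact contDiffAt_ringInverse ℝ u
  exact h.congr_of_eventuallyEq (Filter.eventually_of_mem (hD.isOpen.mem_nhds hx)
    fun y hy => jlInv_eq_inverse (hD.det_ne_zero y hy))

theorem exists_lipschitzOnWith_jlInv {S : Set (Coord N)} (hS : IsCompact S) (hSD : S ⊆ D) :
    ∃ L, LipschitzOnWith L G.jlInv S := by
  refine LocallyLipschitzOn.exists_lipschitzOnWith_of_compact hS fun x hx => ?_
  obtain ⟨L, t, ht, hL⟩ := (contDiffAt_jlInv hD (hSD hx)).exists_lipschitzOnWith
  exact ⟨L, t, mem_nhdsWithin_of_mem_nhds ht, hL⟩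

theorem exists_norm_jlInv_le {S : Set (Coord N)} (hS : IsCompact S) (hSD : S ⊆ D) :
    ∃ B : NNReal, ∀ x ∈ S, ‖G.jlInv x‖ ≤ B := by
  obtain ⟨B, hB⟩ := hS.exists_bound_of_continuousOn (f := G.jlInv)
    fun x hx => (contDiffAt_jlInv hD (hSD hx)).continuousAt.continuousWithinAt
  exact ⟨B.toNNReal, fun x hx => (hB x hx).trans (Real.le_coe_toNNReal B)⟩

theorem jlInv_zero : G.jlInv 0 = 1 := by
  have h : G.jacL 0 = 1 := by
    ext1 v
    have h0 : G.hat (0 : Coord N) = 0 := map_zero G.hatL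
    rw [jacL_apply, h0, neg_zero, NormedSpace.exp_zero, mul_one, expDeriv_zero]
    exact G.veeL_hat v
  rw [jlInv_eq_inverse (hD.det_ne_zero 0 hD.zero_mem), h, Ring.inverse_one]

/-- Along a solution of `y' = -J_l(y)⁻¹ ε` the product `exp(t ε) exp(y(t))` is constant. -/
theorem exp_mul_exp_of_flow {ε : Coord N} {y : ℝ → Coord N} (hyD : ∀ t, y t ∈ D)
    (hy : ∀ t ∈ Set.Icc (0 : ℝ) 1, HasDerivWithinAt y (-(G.jlInv (y t) ε)) (Set.Icc 0 1) t) :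
    NormedSpace.exp (G.hat ε) * NormedSpace.exp (G.hat (y 1)) =
      NormedSpace.exp (G.hat (y 0)) := by
  refine exp_mul_exp_flow G.hatL hy fun t => ?_
  refine (expDeriv_apply (hD.det_ne_zero _ (hyD t)) _).trans ?_
  rw [map_neg, jacL_jlInv (hD.det_ne_zero _ (hyD t)), ← hatL_apply, map_neg]
  rfl

end MatrixLieGroup

/-! ### Left translations in exponential coordinates -/

/-- The analytic properties of the map `h(ε, x) = log^∨(exp(-ε) exp(x))` on which the estimates of
the mean and the covariance rest, for `x` in a compact set `K` and `‖ε‖ ≤ ρ`: the first-order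
expansion `h(ε, x) ≈ x - V(x) ε` has a second-order error uniformly in `x`, also for differences
in `ε`, and `V` is bounded and Lipschitz on `K`. The constants `R`, `B`, `L`, `C` bound the norms
on `K`, the norm and the Lipschitz constant of `V`, and the second-order error. -/
structure IsTranslationChart {E : Type*} [NormedAddCommGroup E] [NormedSpace ℝ E] (K : Set E)
    (V : E → E →L[ℝ] E) (h : E → E → E) (ρ R B L C : ℝ) : Prop where
  pos : 0 < ρ
  R_nonneg : 0 ≤ R
  B_nonneg : 0 ≤ B
  L_nonneg : 0 ≤ L
  C_nonneg : 0 ≤ C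
  isCompact : IsCompact K
  norm_le : ∀ x ∈ K, ‖x‖ ≤ R
  V_zero : V 0 = 1
  norm_V_le : ∀ x ∈ K, ‖V x‖ ≤ B
  norm_V_sub_le : ∀ x ∈ K, ∀ y ∈ K, ‖V x - V y‖ ≤ L * ‖x - y‖
  map_zero : ∀ x ∈ K, h 0 x = x
  continuousOn : ∀ ε, ‖ε‖ ≤ ρ → ContinuousOn (h ε) K
  norm_sub_le : ∀ s ≤ ρ, ∀ ε ε', ‖ε‖ ≤ s → ‖ε'‖ ≤ s → ∀ x ∈ K,
    ‖h ε x - h ε' x + V x (ε - ε')‖ ≤ C * s * ‖ε - ε'‖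

namespace MatrixLieGroup

variable {n N : ℕ} {G : MatrixLieGroup n N}

theorem exp_eq_iff {g : G.carrier} {x : Coord N} : G.exp x = g ↔
    NormedSpace.exp (G.hat x) = ((g : GL (Fin n) ℝ) : Matrix (Fin n) (Fin n) ℝ) := by
  rw [← coe_exp]
  exact ⟨fun h => by rw [h], fun h => Subtype.ext (Units.ext h)⟩

theorem log_eq {D : Set (Coord N)} (hD : G.IsExpDomain D) {g : G.carrier} {x : Coord N}
    (hx : x ∈ D) (hg : G.exp x = g) : G.log D g = x := by
  have h : ∃ y ∈ D, G.exp y = g := ⟨x, hx, hg⟩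
  rw [log, dif_pos h]
  exact hD.injOn (Classical.choose_spec h).1 hx ((Classical.choose_spec h).2.trans hg.symm)

theorem exp_zero : G.exp 0 = 1 := by
  rw [exp_eq_iff, ← hatL_apply, map_zero, NormedSpace.exp_zero]
  rfl

theorem continuous_exp_hat : Continuous fun x => NormedSpace.exp (G.hat x) := by
  open scoped Matrix.Norms.Operator in
  exact (contDiff_exp_comp G.hatL).continuous

/-- A lift through `exp` of a continuous map, with values in a compact part of the domain of
exponential coordinates, is continuous. -/
theorem continuousOn_of_exp_hat {D S K : Set (Coord N)} (hD : G.IsExpDomain D) (hS : IsCompact S)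
    (hSD : S ⊆ D) {f : Coord N → Coord N} (hf : Set.MapsTo f K S)
    (hc : ContinuousOn (fun x => NormedSpace.exp (G.hat (f x))) K) : ContinuousOn f K := by
  have : CompactSpace S := isCompact_iff_compactSpace.1 hS
  have hg : Topology.IsClosedEmbedding fun x : S => NormedSpace.exp (G.hat x) := by
    refine Continuous.isClosedEmbedding (continuous_exp_hat.comp continuous_subtype_val) ?_
    intro x y hxy
    refine Subtype.ext (hD.injOn (hSD x.2) (hSD y.2) (exp_eq_iff.2 ?_))
    rw [coe_exp]
    exact hxy
  rw [continuousOn_iff_continuous_domRestrict] at hc ⊢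
  have h1 : Continuous fun x : K => (⟨f x, hf x.2⟩ : S) :=
    hg.isInducing.continuous_iff.2 hc
  exact continuous_subtype_val.comp h1

/-- Left translation by a small `exp(-ε)` in exponential coordinates is defined on `K`, and
its derivative in `ε` is `-J_l⁻¹`. -/
theorem exists_isTranslationChart {D K : Set (Coord N)} (hD : G.IsExpDomain D)
    (hK : IsCompact K) (hKD : K ⊆ D) :
    ∃ ρ R B L C : ℝ, IsTranslationChart K G.jlInv
        (fun ε x => G.log D ((G.exp ε)⁻¹ * G.exp x)) ρ R B L C ∧
      ∀ ε, ‖ε‖ ≤ ρ → ∀ x ∈ K, (G.exp ε)⁻¹ * G.exp x ∈ G.exp '' D := by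
  obtain ⟨r, hr, hrD⟩ := hK.exists_cthickening_subset_open hD.isOpen hKD
  have hS : IsCompact (Metric.cthickening r K) := hK.cthickening
  obtain ⟨B, hB⟩ := exists_norm_jlInv_le hD hS hrD
  obtain ⟨L, hL⟩ := exists_lipschitzOnWith_jlInv hD hS hrD
  set ρ : ℝ := min (r / (B + 1)) (1 / (2 * (L + 1))) with hρ
  have hρ0 : 0 < ρ := by positivity
  have hBρ : B * ρ ≤ r := by
    have h1 : ρ * (B + 1) ≤ r := (le_div_iff₀ (by positivity)).1 (min_le_left _ _)
    nlinarith
  have hLρ : L * ρ ≤ 1 / 2 := by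
    have h1 : ρ * (2 * (L + 1)) ≤ 1 := (le_div_iff₀ (by positivity)).1 (min_le_right _ _)
    nlinarith
  have hKS : K ⊆ Metric.cthickening r K := Metric.self_subset_cthickening K
  have hflow : ∀ ε x, ‖ε‖ ≤ ρ → x ∈ K → ∃ y : ℝ → Coord N, y 0 = x ∧
      (∀ t, y t ∈ Metric.closedBall x (B * ‖ε‖)) ∧ (∀ t, y t ∈ Metric.cthickening r K) ∧
      (∀ t ∈ Set.Icc (0 : ℝ) 1, HasDerivWithinAt y (-(G.jlInv (y t) ε)) (Set.Icc 0 1) t) ∧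
      G.exp (y 1) = (G.exp ε)⁻¹ * G.exp x ∧
      G.log D ((G.exp ε)⁻¹ * G.exp x) = y 1 := by
    intro ε x hε hx
    have hsub : Metric.closedBall x (B * ‖ε‖) ⊆ Metric.cthickening r K :=
      (Metric.closedBall_subset_closedBall
        ((mul_le_mul_of_nonneg_left hε B.2).trans hBρ)).trans
        (Metric.closedBall_subset_cthickening hx r)
    obtain ⟨y, hy0, hyb, hy⟩ := exists_flow (fun z hz => hB z (hsub hz)) (hL.mono hsub)
    have hyS := fun t => hsub (hyb t)
    have hexp : G.exp (y 1) = (G.exp ε)⁻¹ * G.exp x := by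
      rw [eq_inv_mul_iff_mul_eq]
      refine (exp_eq_iff.2 ?_).symm
      have := exp_mul_exp_of_flow hD (fun t => hrD (hyS t)) hy
      rw [hy0] at this
      rw [← this, Subgroup.coe_mul, Units.val_mul, coe_exp, coe_exp]
    exact ⟨y, hy0, hyb, hyS, hy, hexp, log_eq hD (hrD (hyS 1)) hexp⟩
  have hnorm : ∀ x ∈ Metric.cthickening r K, ∀ y ∈ Metric.cthickening r K,
      ‖G.jlInv x - G.jlInv y‖ ≤ L * ‖x - y‖ := fun x hx y hy => by
    simpa [dist_eq_norm] using hL.dist_le_mul x hx y hy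
  obtain ⟨R, hR0, hR⟩ := hK.isBounded.exists_pos_norm_le
  refine ⟨ρ, R, B, L, 3 * L * B, ⟨hρ0, hR0.le, B.2, L.2, by positivity, hK, hR, jlInv_zero hD,
    fun x hx => hB x (hKS hx), fun x hx y hy => hnorm x (hKS hx) y (hKS hy), fun x hx => ?_,
    fun ε hε => ?_, fun s hs ε ε' hε hε' x hx => ?_⟩, fun ε hε x hx => ?_⟩
  · exact log_eq hD (hKD hx) (by rw [exp_zero, inv_one, one_mul])
  · refine continuousOn_of_exp_hat (K := K) hD hS hrD (fun x hx => ?_) ?_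
    · obtain ⟨y, -, -, hyS, -, -, hlog⟩ := hflow ε x hε hx
      rw [hlog]
      exact hyS 1
    · refine ContinuousOn.congr (f := fun x =>
        (((G.exp ε)⁻¹ : GL (Fin n) ℝ) : Matrix (Fin n) (Fin n) ℝ) * NormedSpace.exp (G.hat x))
        (continuousOn_const.mul continuous_exp_hat.continuousOn) fun x hx => ?_
      obtain ⟨y, -, -, -, -, hexp, hlog⟩ := hflow ε x hε hx
      dsimp only
      rw [hlog, exp_eq_iff.1 hexp, Subgroup.coe_mul, Units.val_mul, G.coe_exp x, Subgroup.coe_inv]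
  · obtain ⟨y, hy0, hyb, hyS, hy, -, hlog⟩ := hflow ε x (hε.trans hs) hx
    obtain ⟨z, hz0, -, hzS, hz, -, hlog'⟩ := hflow ε' x (hε'.trans hs) hx
    rw [hlog, hlog']
    exact norm_flow_sub_flow_le B.2 L.2 hB hnorm (hKS hx) hε hε'
      ((mul_le_mul_of_nonneg_left hs L.2).trans hLρ) hy0 hz0 hyS hzS
      (fun t => (mem_closedBall_iff_norm.1 (hyb t)).trans
        (mul_le_mul_of_nonneg_left hε B.2)) hy hz
  · obtain ⟨y, -, -, hyS, -, hexp, -⟩ := hflow ε x hε hx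
    exact ⟨y 1, hrD (hyS 1), hexp⟩

end MatrixLieGroup

/-! ### Gaussian measures and symmetric convex sets -/

section Gaussian

open scoped RealInnerProductSpace

variable {N : ℕ} {S : Matrix (Fin N) (Fin N) ℝ} {m : Coord N}

theorem map_add_multivariateGaussian (m : Coord N) (S : Matrix (Fin N) (Fin N) ℝ) :
    (multivariateGaussian 0 S).map (fun x => m + x) = multivariateGaussian m S := by
  rw [multivariateGaussian, multivariateGaussian, Measure.map_map (by fun_prop) (by fun_prop)]
  simp [Function.comp_def]

theorem map_neg_multivariateGaussian (S : Matrix (Fin N) (Fin N) ℝ) :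
    (multivariateGaussian 0 S).map (fun x => -x) = multivariateGaussian 0 S := by
  have h := stdGaussian_map (LinearIsometryEquiv.neg ℝ (E := Coord N))
  rw [multivariateGaussian, Measure.map_map (by fun_prop) (by fun_prop)]
  conv_rhs => rw [← h, Measure.map_map (by fun_prop) (by fun_prop)]
  congr 1
  ext1 x
  simp

/-- The mass outside a symmetric convex set at most doubles when a Gaussian is moved to the
origin: if `X + m` and `X - m` both lie in `K`, so does their midpoint `X`, and `X - m ∈ K` has
the probability of `X + m ∈ K` by symmetry. -/
theorem multivariateGaussian_zero_compl_le {K : Set (Coord N)} (hK : MeasurableSet K)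
    (hconv : Convex ℝ K) (hsymm : ∀ x ∈ K, -x ∈ K) :
    (multivariateGaussian 0 S).real Kᶜ ≤ 2 * (multivariateGaussian m S).real Kᶜ := by
  have h1 : (multivariateGaussian 0 S).real ((fun x => m + x) ⁻¹' Kᶜ) =
      (multivariateGaussian m S).real Kᶜ := by
    rw [← map_add_multivariateGaussian m S, map_measureReal_apply (by fun_prop) hK.compl]
  have h2 : (multivariateGaussian 0 S).real ((fun x => m + -x) ⁻¹' Kᶜ) =
      (multivariateGaussian m S).real Kᶜ := by
    rw [← h1]
    conv_rhs => rw [← map_neg_multivariateGaussian S, map_measureReal_apply (by fun_prop)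
      (hK.compl.preimage (by fun_prop))]
    rfl
  have hsub : Kᶜ ⊆ ((fun x => m + x) ⁻¹' Kᶜ) ∪ ((fun x => m + -x) ⁻¹' Kᶜ) := by
    intro x hx
    by_contra h
    simp only [Set.mem_union, Set.mem_preimage, Set.mem_compl_iff, not_or, not_not] at h
    refine hx ?_
    have := hconv h.1 (hsymm _ h.2) (a := 1 / 2) (b := 1 / 2) (by norm_num) (by norm_num)
      (by norm_num)
    convert this using 1
    module
  calc _ ≤ _ := measureReal_mono hsub
    _ ≤ _ := measureReal_union_le _ _
    _ = _ := by rw [h1, h2]; ring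

theorem integrable_inner_mul_inner_multivariateGaussian (u v : Coord N) :
    Integrable (fun x => ⟪u, x⟫ * ⟪v, x⟫) (multivariateGaussian m S) :=
  MemLp.integrable_mul (p := 2) (q := 2) (IsGaussian.memLp_two_id.const_inner u)
    (IsGaussian.memLp_two_id.const_inner v)

theorem integral_inner_multivariateGaussian (u : Coord N) :
    ∫ x, ⟪u, x⟫ ∂(multivariateGaussian m S) = ⟪u, m⟫ := by
  rw [integral_inner (𝕜 := ℝ) (f := fun x => x) IsGaussian.integrable_id,
    integral_id_multivariateGaussian]

theorem integral_inner_mul_inner_multivariateGaussian (hS : S.PosSemidef) (u v : Coord N) :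
    ∫ x, ⟪u, x⟫ * ⟪v, x⟫ ∂(multivariateGaussian m S) =
      ⟪u, Matrix.toEuclideanCLM (n := Fin N) (𝕜 := ℝ) S v⟫ + ⟪u, m⟫ * ⟪v, m⟫ := by
  have h := covarianceBilin_multivariateGaussian (μ := m) hS u v
  have hL : ∀ w : Coord N, MemLp (fun x => ⟪w, x⟫) 2 (multivariateGaussian m S) :=
    fun w => IsGaussian.memLp_two_id.const_inner w
  rw [covarianceBilin_apply_eq_cov IsGaussian.memLp_two_id,
    covariance_eq_sub (hL u) (hL v)] at h
  simp only [Pi.mul_apply] at h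
  rw [integral_inner_multivariateGaussian, integral_inner_multivariateGaussian] at h
  rw [Matrix.inner_toEuclideanCLM]
  linarith

theorem integrable_norm_sq_multivariateGaussian :
    Integrable (fun x => ‖x‖ ^ 2) (multivariateGaussian m S) :=
  IsGaussian.memLp_two_id.integrable_norm_pow (by norm_num)

theorem integral_norm_sq_multivariateGaussian_le (hS : S.PosSemidef) :
    ∫ x, ‖x‖ ^ 2 ∂(multivariateGaussian 0 S) ≤ N * spectralNorm₂ S := by
  have h : ∀ x : Coord N, ‖x‖ ^ 2 = ∑ i, ⟪EuclideanSpace.basisFun (Fin N) ℝ i, x⟫ *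
      ⟪EuclideanSpace.basisFun (Fin N) ℝ i, x⟫ := fun x => by
    rw [← (EuclideanSpace.basisFun (Fin N) ℝ).sum_sq_inner_right x]
    exact Finset.sum_congr rfl fun i _ => sq _
  simp_rw [h]
  rw [integral_finsetSum _ fun i _ => integrable_inner_mul_inner_multivariateGaussian _ _]
  calc _ ≤ ∑ _i : Fin N, spectralNorm₂ S := Finset.sum_le_sum fun i _ => ?_
    _ = _ := by simp
  rw [integral_inner_mul_inner_multivariateGaussian hS, inner_zero_right, mul_zero, add_zero]
  refine (real_inner_le_norm _ _).trans ?_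
  have := (Matrix.toEuclideanCLM (n := Fin N) (𝕜 := ℝ) S).le_opNorm
    (EuclideanSpace.basisFun (Fin N) ℝ i)
  simpa [spectralNorm₂] using this

end Gaussian

/-! ### Replacing the posterior by a centred Gaussian -/

/-- A probability measure `p` supported in a compact, convex, symmetric set `K` and at distance at
most `η` from the Gaussian `N(m, S)`, in total variation weighted by `1 + ‖x‖²`. -/
structure IsNearGaussian {N : ℕ} (K : Set (Coord N)) (p : Measure (Coord N)) (m : Coord N)
    (S : Matrix (Fin N) (Fin N) ℝ) (η : ℝ) : Prop where
  isProbabilityMeasure : IsProbabilityMeasure p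
  ae_mem : ∀ᵐ x ∂p, x ∈ K
  posSemidef : S.PosSemidef
  isCompact : IsCompact K
  convex : Convex ℝ K
  neg_mem : ∀ x ∈ K, -x ∈ K
  abs_integral_sub_le : ∀ f : Coord N → ℝ, Measurable f → (∀ x, |f x| ≤ 1 + ‖x‖ ^ 2) →
    |∫ x, f x ∂p - ∫ x, f x ∂(multivariateGaussian m S)| ≤ η

namespace IsNearGaussian

open scoped RealInnerProductSpace

variable {N : ℕ} {K : Set (Coord N)} {p : Measure (Coord N)} {m : Coord N}
  {S : Matrix (Fin N) (Fin N) ℝ} {η : ℝ} (H : IsNearGaussian K p m S η)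
include H

theorem nonneg : 0 ≤ η := by
  simpa using H.abs_integral_sub_le (fun _ => 0) measurable_const fun x => by
    simp only [abs_zero]; positivity

theorem zero_mem : (0 : Coord N) ∈ K := by
  have := H.isProbabilityMeasure
  obtain ⟨x, hx⟩ := H.ae_mem.exists
  have := H.convex hx (H.neg_mem x hx) (a := 1 / 2) (b := 1 / 2) (by norm_num) (by norm_num)
    (by norm_num)
  simpa using this

theorem abs_integral_sub_le_mul {f : Coord N → ℝ} {c : ℝ} (hf : Measurable f) (hc : 0 ≤ c)
    (hb : ∀ x, |f x| ≤ c * (1 + ‖x‖ ^ 2)) :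
    |∫ x, f x ∂p - ∫ x, f x ∂(multivariateGaussian m S)| ≤ c * η := by
  rcases hc.eq_or_lt with rfl | hc
  · have : f = fun _ => 0 := by
      ext1 x
      simpa using hb x
    simp [this]
  · have h := H.abs_integral_sub_le (fun x => c⁻¹ * f x) (hf.const_mul _) fun x => by
      rw [abs_mul, abs_of_pos (inv_pos.2 hc), inv_mul_le_iff₀ hc]
      exact hb x
    rwa [integral_const_mul, integral_const_mul, ← mul_sub, abs_mul, abs_of_pos (inv_pos.2 hc),
      inv_mul_le_iff₀ hc] at h

theorem measureReal_compl_le : (multivariateGaussian m S).real Kᶜ ≤ η := by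
  have hK := H.isCompact.measurableSet
  have h := H.abs_integral_sub_le (Kᶜ.indicator fun _ => 1)
    (measurable_const.indicator hK.compl) fun x => by
      have : (0 : ℝ) ≤ ‖x‖ ^ 2 := by positivity
      by_cases hx : x ∈ Kᶜ
      · simp [Set.indicator_of_mem hx, this]
      · rw [Set.indicator_of_notMem hx, abs_zero]
        linarith
  have h0 : p.real Kᶜ = 0 := by
    rw [measureReal_def, show p Kᶜ = 0 from H.ae_mem, ENNReal.toReal_zero]
  rw [integral_indicator_const _ hK.compl, integral_indicator_const _ hK.compl, h0] at h
  exact (le_abs_self _).trans (by simpa using h)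

theorem measureReal_zero_compl_le : (multivariateGaussian 0 S).real Kᶜ ≤ 2 * η :=
  (multivariateGaussian_zero_compl_le (m := m) H.isCompact.measurableSet H.convex
    H.neg_mem).trans (by linarith [H.measureReal_compl_le])

/-- The integral over `p` of a bounded Lipschitz function is close to the one over the restriction
to `K` of the centred Gaussian: besides the approximation error, the shift by `m` costs `l ‖m‖`
where both `x` and `m + x` are in `K`, and `O(η)` elsewhere. -/
theorem abs_integral_sub_setIntegral_le {φ : Coord N → ℝ} {b l : ℝ} (hb0 : 0 ≤ b) (hl0 : 0 ≤ l)
    (hb : ∀ x ∈ K, |φ x| ≤ b) (hl : ∀ x ∈ K, ∀ y ∈ K, |φ x - φ y| ≤ l * ‖x - y‖) :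
    |∫ x, φ x ∂p - ∫ x in K, φ x ∂(multivariateGaussian 0 S)| ≤ (4 * b + l) * (‖m‖ + η) := by
  classical
  have hη := H.nonneg
  have hK := H.isCompact.measurableSet
  have hφ : ContinuousOn φ K := by
    refine (LipschitzOnWith.of_dist_le_mul (K := l.toNNReal) fun x hx y hy => ?_).continuousOn
    rw [Real.dist_eq, dist_eq_norm, Real.coe_toNNReal l hl0]
    exact hl x hx y hy
  have hψm : Measurable (K.indicator φ) := by
    rw [← Set.piecewise_eq_indicator]
    exact hφ.measurable_piecewise continuousOn_const hK
  have hψb : ∀ x, |K.indicator φ x| ≤ b := fun x => by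
    by_cases hx : x ∈ K
    · simpa [hx] using hb x hx
    · simpa [hx] using hb0
  have h1 : ∫ x, φ x ∂p = ∫ x, K.indicator φ x ∂p :=
    integral_congr_ae (H.ae_mem.mono fun x hx => (Set.indicator_of_mem hx φ).symm)
  have h2 : |∫ x, K.indicator φ x ∂p - ∫ x, K.indicator φ x ∂(multivariateGaussian m S)| ≤
      b * η := H.abs_integral_sub_le_mul hψm hb0 fun x =>
    (hψb x).trans (le_mul_of_one_le_right hb0 (by nlinarith [norm_nonneg x]))
  have hint : Integrable (K.indicator φ) (multivariateGaussian 0 S) :=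
    Integrable.of_bound hψm.aestronglyMeasurable b (Filter.Eventually.of_forall hψb)
  have hint' : Integrable (fun x => K.indicator φ (m + x)) (multivariateGaussian 0 S) :=
    Integrable.of_bound (hψm.comp (by fun_prop)).aestronglyMeasurable b
      (Filter.Eventually.of_forall fun x => hψb _)
  have hKm : MeasurableSet ((fun x => m + x) ⁻¹' Kᶜ) := hK.compl.preimage (by fun_prop)
  have h3 : |∫ x, K.indicator φ x ∂(multivariateGaussian m S) -
      ∫ x, K.indicator φ x ∂(multivariateGaussian 0 S)| ≤ l * ‖m‖ + b * (2 * η) + b * η := by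
    rw [← map_add_multivariateGaussian m S,
      integral_map (by fun_prop) hψm.aestronglyMeasurable, ← integral_sub hint' hint]
    have i1 : Integrable (Kᶜ.indicator fun _ => b) (multivariateGaussian 0 S) :=
      (integrable_const b).indicator hK.compl
    have i2 : Integrable (((fun x => m + x) ⁻¹' Kᶜ).indicator fun _ => b)
      (multivariateGaussian 0 S) := (integrable_const b).indicator hKm
    have hle : ∀ x, ‖K.indicator φ (m + x) - K.indicator φ x‖ ≤
        l * ‖m‖ + Kᶜ.indicator (fun _ => b) x +
          ((fun x => m + x) ⁻¹' Kᶜ).indicator (fun _ => b) x := by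
      intro x
      have h0 : 0 ≤ l * ‖m‖ := by positivity
      by_cases hx : x ∈ K <;> by_cases hy : m + x ∈ K
      · simpa [hx, hy] using hl _ hy _ hx
      · have := hb _ hx
        simp [hx, hy]; linarith
      · have := hb _ hy
        simp [hx, hy]; linarith
      · simp [hx, hy]; linarith
    have i3 : Integrable (fun x => l * ‖m‖ + Kᶜ.indicator (fun _ => b) x)
      (multivariateGaussian 0 S) := (integrable_const _).add i1
    refine (norm_integral_le_of_norm_le (i3.add i2)
      (Filter.Eventually.of_forall hle)).trans ?_
    have e1 : (multivariateGaussian 0 S).real ((fun x => m + x) ⁻¹' Kᶜ) ≤ η := by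
      rw [← map_measureReal_apply (by fun_prop) hK.compl, map_add_multivariateGaussian]
      exact H.measureReal_compl_le
    have e2 := H.measureReal_zero_compl_le
    simp only [Pi.add_apply]
    rw [integral_add i3 i2, integral_add (integrable_const _) i1,
      integral_indicator_const _ hK.compl, integral_indicator_const _ hKm]
    simp only [integral_const, probReal_univ, smul_eq_mul, one_mul]
    nlinarith
  rw [h1, ← integral_indicator hK]
  refine (abs_sub_le _ _ _).trans ((add_le_add h2 h3).trans ?_)
  nlinarith [mul_nonneg hb0 (norm_nonneg m), mul_nonneg hl0 hη]

theorem abs_integral_inner_sub_le (u : Coord N) : |∫ x, ⟪u, x⟫ ∂p - ⟪u, m⟫| ≤ ‖u‖ * η := by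
  rw [← integral_inner_multivariateGaussian (m := m) (S := S)]
  refine H.abs_integral_sub_le_mul (by fun_prop) (norm_nonneg u) fun x =>
    (abs_real_inner_le_norm u x).trans (mul_le_mul_of_nonneg_left ?_ (norm_nonneg u))
  nlinarith [sq_nonneg (‖x‖ - 1)]

theorem abs_integral_inner_mul_inner_sub_le (u v : Coord N) :
    |∫ x, ⟪u, x⟫ * ⟪v, x⟫ ∂p - (⟪u, Matrix.toEuclideanCLM (n := Fin N) (𝕜 := ℝ) S v⟫ +
      ⟪u, m⟫ * ⟪v, m⟫)| ≤ ‖u‖ * ‖v‖ * η := by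
  rw [← integral_inner_mul_inner_multivariateGaussian H.posSemidef]
  refine H.abs_integral_sub_le_mul (by fun_prop) (by positivity) fun x => ?_
  rw [abs_mul]
  have h1 := mul_le_mul (abs_real_inner_le_norm u x) (abs_real_inner_le_norm v x)
    (abs_nonneg _) (by positivity)
  have h2 : 0 ≤ ‖u‖ * ‖v‖ := by positivity
  linarith

theorem norm_integral_sub_le (hint : Integrable (fun x => x) p) : ‖∫ x, x ∂p - m‖ ≤ η := by
  have h := H.abs_integral_inner_sub_le (∫ x, x ∂p - m)
  rw [integral_inner (𝕜 := ℝ) (f := fun x => x) hint, ← inner_sub_right,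
    real_inner_self_eq_norm_sq, abs_of_nonneg (by positivity)] at h
  rcases (norm_nonneg (∫ x, x ∂p - m)).eq_or_lt with h0 | h0
  · rw [← h0]
    exact H.nonneg
  · nlinarith

end IsNearGaussian

/-! ### The group-theoretic mean -/

open scoped RealInnerProductSpace in
theorem opNorm_le_of_abs_inner_le {E : Type*} [NormedAddCommGroup E] [InnerProductSpace ℝ E]
    {T : E →L[ℝ] E} {c : ℝ} (hc : 0 ≤ c) (h : ∀ u v, |⟪u, T v⟫| ≤ c * (‖u‖ * ‖v‖)) :
    ‖T‖ ≤ c := by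
  refine T.opNorm_le_bound hc fun v => ?_
  have h1 := h (T v) v
  rw [real_inner_self_eq_norm_sq, abs_of_nonneg (by positivity)] at h1
  rcases (norm_nonneg (T v)).eq_or_lt with h0 | h0
  · rw [← h0]; positivity
  · nlinarith

theorem norm_integral_le_of_ae_norm_le {α F : Type*} [MeasurableSpace α] {μ : Measure α}
    [IsProbabilityMeasure μ] [NormedAddCommGroup F] [NormedSpace ℝ F] {f : α → F} {c : ℝ}
    (hf : ∀ᵐ x ∂μ, ‖f x‖ ≤ c) : ‖∫ x, f x ∂μ‖ ≤ c := by
  simpa using norm_integral_le_of_norm_le_const hf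

namespace IsTranslationChart

variable {E : Type*} [NormedAddCommGroup E] [NormedSpace ℝ E] {K : Set E} {V : E → E →L[ℝ] E}
  {h : E → E → E} {ρ R B L C : ℝ} (T : IsTranslationChart K V h ρ R B L C)
include T

theorem continuousOn_V : ContinuousOn V K := by
  refine (LipschitzOnWith.of_dist_le_mul (K := L.toNNReal) fun x hx y hy => ?_).continuousOn
  rw [dist_eq_norm, dist_eq_norm, Real.coe_toNNReal L T.L_nonneg]
  exact T.norm_V_sub_le x hx y hy

theorem norm_V_apply_le {x : E} (hx : x ∈ K) (v : E) : ‖V x v‖ ≤ B * ‖v‖ :=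
  (V x).le_of_opNorm_le (T.norm_V_le x hx) v

theorem norm_remainder_le {ε x : E} (hε : ‖ε‖ ≤ ρ) (hx : x ∈ K) :
    ‖h ε x - x + V x ε‖ ≤ C * ‖ε‖ ^ 2 := by
  have := T.norm_sub_le ‖ε‖ hε ε 0 le_rfl (by simp) x hx
  rw [T.map_zero x hx, sub_zero] at this
  exact this.trans_eq (by ring)

end IsTranslationChart

namespace IsNearGaussian

open scoped RealInnerProductSpace

variable {N : ℕ} {K : Set (Coord N)} {p : Measure (Coord N)} {m : Coord N}
  {S : Matrix (Fin N) (Fin N) ℝ} {η : ℝ} (H : IsNearGaussian K p m S η)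

section

include H

theorem integrable_of_continuousOn {F : Type*} [NormedAddCommGroup F] {f : Coord N → F}
    (hf : ContinuousOn f K) : Integrable f p := by
  have := H.isProbabilityMeasure
  rw [← Measure.restrict_eq_self_of_ae_mem H.ae_mem]
  exact hf.integrableOn_compact H.isCompact

theorem inner_integral_apply {W : Coord N → Coord N →L[ℝ] Coord N} (hW : ContinuousOn W K)
    (u v : Coord N) : ⟪u, (∫ x, W x ∂p) v⟫ = ∫ x, ⟪u, W x v⟫ ∂p := by
  have hi := H.integrable_of_continuousOn hW
  rw [ContinuousLinearMap.integral_apply hi,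
    integral_inner (𝕜 := ℝ) (hi.apply_continuousLinearMap v)]

theorem inner_setIntegral_apply {W : Coord N → Coord N →L[ℝ] Coord N} (hW : ContinuousOn W K)
    (u v : Coord N) : ⟪u, (∫ x in K, W x ∂(multivariateGaussian 0 S)) v⟫ =
      ∫ x in K, ⟪u, W x v⟫ ∂(multivariateGaussian 0 S) := by
  have hi : IntegrableOn W K (multivariateGaussian 0 S) := hW.integrableOn_compact H.isCompact
  rw [ContinuousLinearMap.integral_apply hi,
    integral_inner (𝕜 := ℝ) (hi.apply_continuousLinearMap v)]

end

variable {V : Coord N → Coord N →L[ℝ] Coord N} {h : Coord N → Coord N → Coord N}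
  {ρ R B L C : ℝ} (T : IsTranslationChart K V h ρ R B L C)
include H T

theorem norm_integral_V_sub_le :
    ‖∫ x, V x ∂p - ∫ x in K, V x ∂(multivariateGaussian 0 S)‖ ≤ (4 * B + L) * (‖m‖ + η) := by
  have hη := H.nonneg
  have hB := T.B_nonneg
  have hL := T.L_nonneg
  refine opNorm_le_of_abs_inner_le (by positivity) fun u v => ?_
  rw [_root_.sub_apply, inner_sub_right, H.inner_integral_apply T.continuousOn_V,
    H.inner_setIntegral_apply T.continuousOn_V]
  refine (H.abs_integral_sub_setIntegral_le (b := B * (‖u‖ * ‖v‖)) (l := L * (‖u‖ * ‖v‖))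
    (by positivity) (by positivity) (fun x hx => ?_) fun x hx y hy => ?_).trans_eq (by ring)
  · refine (abs_real_inner_le_norm _ _).trans ?_
    nlinarith [mul_le_mul_of_nonneg_left (T.norm_V_apply_le hx v) (norm_nonneg u)]
  · rw [← inner_sub_right, ← _root_.sub_apply]
    refine (abs_real_inner_le_norm _ _).trans ?_
    nlinarith [mul_le_mul_of_nonneg_left
      ((V x - V y).le_of_opNorm_le (T.norm_V_sub_le x hx y hy) v) (norm_nonneg u)]

/-- The average of `V` under the centred Gaussian is close to `V(0) = 1` if the covariance is
small. -/
theorem norm_setIntegral_V_sub_one_le :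
    ‖∫ x in K, V x ∂(multivariateGaussian 0 S) - 1‖ ≤
      1 / 16 + 4 * L ^ 2 * (N * spectralNorm₂ S) + 2 * η := by
  have hK := H.isCompact.measurableSet
  have hi : IntegrableOn V K (multivariateGaussian 0 S) :=
    T.continuousOn_V.integrableOn_compact H.isCompact
  have h1 : ∫ x in K, V x ∂(multivariateGaussian 0 S) - 1 =
      ∫ x in K, (V x - 1) ∂(multivariateGaussian 0 S) -
        (multivariateGaussian 0 S).real Kᶜ • (1 : Coord N →L[ℝ] Coord N) := by
    rw [integral_sub hi (integrable_const _), setIntegral_const, sub_sub, ← add_smul,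
      measureReal_add_measureReal_compl hK, probReal_univ, one_smul]
  have hi2 : Integrable (fun x => 1 / 16 + 4 * L ^ 2 * ‖x‖ ^ 2) (multivariateGaussian 0 S) :=
    (integrable_const _).add (integrable_norm_sq_multivariateGaussian.const_mul _)
  have h2 : ‖∫ x in K, (V x - 1) ∂(multivariateGaussian 0 S)‖ ≤
      1 / 16 + 4 * L ^ 2 * (N * spectralNorm₂ S) := by
    calc _ ≤ ∫ x in K, (1 / 16 + 4 * L ^ 2 * ‖x‖ ^ 2) ∂(multivariateGaussian 0 S) := by
          refine norm_integral_le_of_norm_le hi2.integrableOn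
            ((ae_restrict_iff' hK).2 (Filter.Eventually.of_forall fun x hx => ?_))
          have := T.norm_V_sub_le x hx 0 H.zero_mem
          rw [T.V_zero, sub_zero] at this
          -- `L ‖x‖ ≤ 1 / 16 + 4 (L ‖x‖)²` reduces the first moment to the second one
          nlinarith [sq_nonneg (2 * L * ‖x‖ - 1 / 4)]
      _ ≤ ∫ x, (1 / 16 + 4 * L ^ 2 * ‖x‖ ^ 2) ∂(multivariateGaussian 0 S) :=
          setIntegral_le_integral hi2 (Filter.Eventually.of_forall fun x => by positivity)
      _ ≤ _ := by
          rw [integral_add (integrable_const _)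
            (integrable_norm_sq_multivariateGaussian.const_mul _), integral_const_mul]
          simp only [integral_const, probReal_univ, one_smul]
          gcongr
          exact integral_norm_sq_multivariateGaussian_le H.posSemidef
  have h3 : ‖(multivariateGaussian 0 S).real Kᶜ • (1 : Coord N →L[ℝ] Coord N)‖ ≤ 2 * η := by
    rw [norm_smul, Real.norm_eq_abs, abs_of_nonneg measureReal_nonneg]
    have : ‖(1 : Coord N →L[ℝ] Coord N)‖ ≤ 1 := ContinuousLinearMap.norm_id_le
    nlinarith [H.measureReal_zero_compl_le, measureReal_nonneg (μ := multivariateGaussian 0 S)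
      (s := Kᶜ)]
  rw [h1]
  exact (norm_sub_le _ _).trans (add_le_add h2 h3)

theorem norm_integral_sub_integral_le {s : ℝ} (hs : s ≤ ρ) {ε ε' : Coord N} (hε : ‖ε‖ ≤ s)
    (hε' : ‖ε'‖ ≤ s) :
    ‖∫ x, h ε x ∂p - ∫ x, h ε' x ∂p + (∫ x, V x ∂p) (ε - ε')‖ ≤ C * s * ‖ε - ε'‖ := by
  have := H.isProbabilityMeasure
  have i1 := H.integrable_of_continuousOn (T.continuousOn ε (hε.trans hs))
  have i2 := H.integrable_of_continuousOn (T.continuousOn ε' (hε'.trans hs))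
  have i3 := H.integrable_of_continuousOn T.continuousOn_V
  have i4 : Integrable (fun x => h ε x - h ε' x) p := i1.sub i2
  rw [ContinuousLinearMap.integral_apply i3, ← integral_sub i1 i2,
    ← integral_add i4 (i3.apply_continuousLinearMap _)]
  exact norm_integral_le_of_ae_norm_le
    (H.ae_mem.mono fun x hx => T.norm_sub_le s hs ε ε' hε hε' x hx)

/-- `ε ↦ ε + ∫ h(ε, x) dp` is a contraction of a small ball: the derivative of the integral is
close to `-1`. -/
theorem norm_add_integral_sub_le {s : ℝ} (hs : s ≤ ρ) (hCs : C * s ≤ 1 / 4)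
    (hV : ‖∫ x, V x ∂p - 1‖ ≤ 1 / 2) {ε ε' : Coord N} (hε : ‖ε‖ ≤ s) (hε' : ‖ε'‖ ≤ s) :
    ‖(ε + ∫ x, h ε x ∂p) - (ε' + ∫ x, h ε' x ∂p)‖ ≤ 3 / 4 * ‖ε - ε'‖ := by
  have h1 := H.norm_integral_sub_integral_le T hs hε hε'
  have h2 := (∫ x, V x ∂p - 1).le_of_opNorm_le hV (ε - ε')
  have h3 : (ε + ∫ x, h ε x ∂p) - (ε' + ∫ x, h ε' x ∂p) =
      (∫ x, h ε x ∂p - ∫ x, h ε' x ∂p + (∫ x, V x ∂p) (ε - ε')) -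
        (∫ x, V x ∂p - 1) (ε - ε') := by
    rw [_root_.sub_apply, one_apply_eq_self]
    abel
  rw [h3]
  refine (norm_sub_le _ _).trans ?_
  nlinarith [mul_le_mul_of_nonneg_right hCs (norm_nonneg (ε - ε'))]

theorem norm_integral_map_zero_le : ‖∫ x, h 0 x ∂p‖ ≤ ‖m‖ + η := by
  have h1 : ∫ x, h 0 x ∂p = ∫ x, x ∂p := integral_congr_ae (H.ae_mem.mono T.map_zero)
  have h2 := H.norm_integral_sub_le (H.integrable_of_continuousOn continuousOn_id)
  rw [h1]
  have := norm_le_norm_add_norm_sub' (∫ x, x ∂p) m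
  linarith

theorem exists_integral_eq_zero {s : ℝ} (hs0 : 0 ≤ s) (hs : s ≤ ρ) (hCs : C * s ≤ 1 / 4)
    (hV : ‖∫ x, V x ∂p - 1‖ ≤ 1 / 2) (hm : ‖m‖ + η ≤ s / 4) :
    ∃ ε, ‖ε‖ ≤ s ∧ ∫ x, h ε x ∂p = 0 := by
  have h0 := H.norm_integral_map_zero_le T
  have hmaps : Set.MapsTo (fun ε => ε + ∫ x, h ε x ∂p) (Metric.closedBall 0 s)
      (Metric.closedBall 0 s) := fun ε hε => by
    rw [mem_closedBall_zero_iff] at hε ⊢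
    have h1 := H.norm_add_integral_sub_le T hs hCs hV hε (ε' := 0) (by simpa using hs0)
    rw [zero_add, sub_zero] at h1
    have := norm_le_norm_add_norm_sub' (ε + ∫ x, h ε x ∂p) (∫ x, h 0 x ∂p)
    linarith
  have hc : ContractingWith (3 / 4) (hmaps.restrict _ _ _) := by
    refine ⟨by rw [← NNReal.coe_lt_coe]; norm_num, LipschitzWith.of_dist_le_mul fun x y => ?_⟩
    rw [Subtype.dist_eq, Subtype.dist_eq, dist_eq_norm, dist_eq_norm]
    exact H.norm_add_integral_sub_le T hs hCs hV (mem_closedBall_zero_iff.1 x.2)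
      (mem_closedBall_zero_iff.1 y.2)
  obtain ⟨ε, hε, hfix, -⟩ := hc.exists_fixedPoint' Metric.isClosed_closedBall.isComplete hmaps
    (x := 0) (by simpa using hs0) (edist_ne_top _ _)
  exact ⟨ε, mem_closedBall_zero_iff.1 hε, by simpa [Function.IsFixedPt] using hfix⟩

theorem eq_of_integral_eq_zero {s : ℝ} (hs : s ≤ ρ) (hCs : C * s ≤ 1 / 4)
    (hV : ‖∫ x, V x ∂p - 1‖ ≤ 1 / 2) {ε ε' : Coord N} (hε : ‖ε‖ ≤ s) (hε' : ‖ε'‖ ≤ s)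
    (h0 : ∫ x, h ε x ∂p = 0) (h0' : ∫ x, h ε' x ∂p = 0) : ε' = ε := by
  have h1 := H.norm_add_integral_sub_le T hs hCs hV hε' hε
  rw [h0, h0', add_zero, add_zero] at h1
  have h2 : ‖ε' - ε‖ ≤ 0 := by linarith
  exact sub_eq_zero.1 (norm_le_zero_iff.1 h2)

theorem norm_le_of_integral_eq_zero {s : ℝ} (hs : s ≤ ρ) (hCs : C * s ≤ 1 / 4)
    (hV : ‖∫ x, V x ∂p - 1‖ ≤ 1 / 2) {ε : Coord N} (hε : ‖ε‖ ≤ s)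
    (h0 : ∫ x, h ε x ∂p = 0) : ‖ε‖ ≤ 4 * (‖m‖ + η) := by
  have h1 := H.norm_add_integral_sub_le T hs hCs hV hε (ε' := 0)
    (by simpa using (norm_nonneg ε).trans hε)
  rw [h0, add_zero, zero_add, sub_zero] at h1
  have := norm_le_norm_add_norm_sub' ε (∫ x, h 0 x ∂p)
  linarith [H.norm_integral_map_zero_le T]

/-- The zero `ε` of the integral agrees to second order, up to `O(η)`, with the solution `m'` of the
linearized equation `⟨V⟩ m' = m`. -/
theorem norm_sub_corrected_le {s : ℝ} (hs : s ≤ ρ) (hCs : C * s ≤ 1 / 4)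
    (hV : ‖∫ x, V x ∂p - 1‖ ≤ 1 / 2)
    (hV₀ : ‖∫ x in K, V x ∂(multivariateGaussian 0 S) - 1‖ ≤ 1 / 2) (hη : η ≤ 1) {m' : Coord N}
    (hm' : (∫ x in K, V x ∂(multivariateGaussian 0 S)) m' = m) (hmm' : ‖m‖ ≤ 2 * ‖m'‖)
    {ε : Coord N} (hε : ‖ε‖ ≤ s) (h0 : ∫ x, h ε x ∂p = 0) :
    ‖ε - m'‖ ≤ 2 * (1 + 128 * C + 32 * (4 * B + L)) * (‖m'‖ ^ 2 + η) := by
  have hη0 := H.nonneg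
  have hC := T.C_nonneg
  have hB := T.B_nonneg
  have hL := T.L_nonneg
  set A := ∫ x in K, V x ∂(multivariateGaussian 0 S)
  set Ap := ∫ x, V x ∂p
  have h1 := H.norm_integral_sub_integral_le T (s := ‖ε‖) (hε.trans hs) (ε := ε) (ε' := 0) le_rfl
    (by simp)
  have h2 := H.norm_integral_sub_le (H.integrable_of_continuousOn continuousOn_id)
  have h3 := (Ap - A).le_of_opNorm_le (H.norm_integral_V_sub_le T) ε
  have h4 : ∫ x, h 0 x ∂p = ∫ x, x ∂p := integral_congr_ae (H.ae_mem.mono T.map_zero)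
  rw [h0, h4, sub_zero, zero_sub] at h1
  have h5 : A (ε - m') = (-∫ x, x ∂p + Ap ε) + (∫ x, x ∂p - m) - (Ap - A) ε := by
    rw [map_sub, hm', _root_.sub_apply]
    abel
  have h6 : ‖A (ε - m')‖ ≤ C * ‖ε‖ * ‖ε‖ + η + (4 * B + L) * (‖m‖ + η) * ‖ε‖ := by
    rw [h5]
    exact (norm_sub_le _ _).trans (add_le_add ((norm_add_le _ _).trans (add_le_add h1 h2)) h3)
  have h7 : ‖ε - m'‖ ≤ 2 * ‖A (ε - m')‖ := by
    have := (A - 1).le_of_opNorm_le hV₀ (ε - m')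
    rw [_root_.sub_apply, one_apply_eq_self] at this
    have h8 := norm_le_norm_add_norm_sub (A (ε - m')) (ε - m')
    linarith
  have h8 := H.norm_le_of_integral_eq_zero T hs hCs hV hε h0
  have h9 : ‖m‖ + η ≤ 2 * ‖m'‖ + η := by linarith
  have h10 : (‖m‖ + η) ^ 2 ≤ 8 * (‖m'‖ ^ 2 + η) := by
    have := pow_le_pow_left₀ (by positivity) h9 2
    nlinarith [sq_nonneg (2 * ‖m'‖ - η), norm_nonneg m']
  have h11 : ‖ε‖ * ‖ε‖ ≤ 128 * (‖m'‖ ^ 2 + η) := by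
    have := mul_le_mul h8 h8 (norm_nonneg _) (by positivity)
    nlinarith
  have h12 : (‖m‖ + η) * ‖ε‖ ≤ 32 * (‖m'‖ ^ 2 + η) := by
    have := mul_le_mul_of_nonneg_left h8 (by positivity : 0 ≤ ‖m‖ + η)
    nlinarith
  have h13 := mul_le_mul_of_nonneg_left h11 hC
  have h14 := mul_le_mul_of_nonneg_left h12 (by positivity : 0 ≤ 4 * B + L)
  nlinarith [sq_nonneg ‖m'‖]

end IsNearGaussian

/-! ### The covariance about the mean -/

/-- Multiplying two expansions `a - a₁ + a₂` and `b - b₁ + b₂`, with terms of order `0`, `1`, `2` in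
`e`, leaves a second-order error after the first-order terms. -/
theorem abs_mul_sub_linearization_le {a a₁ a₂ b b₁ b₂ R B C e U W : ℝ} (hR : 0 ≤ R) (hB : 0 ≤ B)
    (hC : 0 ≤ C) (he0 : 0 ≤ e) (he : e ≤ 1) (hU : 0 ≤ U) (hW : 0 ≤ W)
    (ha : |a| ≤ R * U) (ha₁ : |a₁| ≤ B * e * U) (ha₂ : |a₂| ≤ C * e ^ 2 * U)
    (hb : |b| ≤ R * W) (hb₁ : |b₁| ≤ B * e * W) (hb₂ : |b₂| ≤ C * e ^ 2 * W) :
    |(a - a₁ + a₂) * (b - b₁ + b₂) - (a * b - a₁ * b - b₁ * a)| ≤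
      (2 * R * C + B ^ 2 + 2 * B * C + C ^ 2) * e ^ 2 * (U * W) := by
  have h : (a - a₁ + a₂) * (b - b₁ + b₂) - (a * b - a₁ * b - b₁ * a) =
      a * b₂ + a₁ * b₁ - a₁ * b₂ + a₂ * b - a₂ * b₁ + a₂ * b₂ := by ring
  have he2 : e ^ 2 ≤ 1 := pow_le_one₀ he0 he
  have h1 : |a * b₂| ≤ R * C * e ^ 2 * (U * W) := by
    rw [abs_mul]
    exact (mul_le_mul ha hb₂ (abs_nonneg _) (by positivity)).trans_eq (by ring)
  have h2 : |a₁ * b₁| ≤ B ^ 2 * e ^ 2 * (U * W) := by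
    rw [abs_mul]
    exact (mul_le_mul ha₁ hb₁ (abs_nonneg _) (by positivity)).trans_eq (by ring)
  have h3 : |a₁ * b₂| ≤ B * C * e ^ 2 * (U * W) := by
    rw [abs_mul]
    refine (mul_le_mul ha₁ hb₂ (abs_nonneg _) (by positivity)).trans ?_
    have := mul_le_mul_of_nonneg_left he (by positivity : 0 ≤ B * C * e ^ 2 * (U * W))
    linarith
  have h4 : |a₂ * b| ≤ R * C * e ^ 2 * (U * W) := by
    rw [abs_mul]
    exact (mul_le_mul ha₂ hb (abs_nonneg _) (by positivity)).trans_eq (by ring)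
  have h5 : |a₂ * b₁| ≤ B * C * e ^ 2 * (U * W) := by
    rw [abs_mul]
    refine (mul_le_mul ha₂ hb₁ (abs_nonneg _) (by positivity)).trans ?_
    have := mul_le_mul_of_nonneg_left he (by positivity : 0 ≤ B * C * e ^ 2 * (U * W))
    linarith
  have h6 : |a₂ * b₂| ≤ C ^ 2 * e ^ 2 * (U * W) := by
    rw [abs_mul]
    refine (mul_le_mul ha₂ hb₂ (abs_nonneg _) (by positivity)).trans ?_
    have := mul_le_mul_of_nonneg_left he2 (by positivity : 0 ≤ C ^ 2 * e ^ 2 * (U * W))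
    linarith
  rw [h]
  rw [abs_le] at *
  constructor <;> linarith

namespace IsNearGaussian

open scoped RealInnerProductSpace

variable {N : ℕ} {K : Set (Coord N)} {p : Measure (Coord N)} {m : Coord N}
  {S : Matrix (Fin N) (Fin N) ℝ} {η : ℝ} (H : IsNearGaussian K p m S η)
  {V : Coord N → Coord N →L[ℝ] Coord N} {h : Coord N → Coord N → Coord N}
  {ρ R B L C : ℝ} (T : IsTranslationChart K V h ρ R B L C)
include T

theorem _root_.IsTranslationChart.continuousOn_inner_V_mul (u v w : Coord N) :
    ContinuousOn (fun x => ⟪u, V x w⟫ * ⟪v, x⟫) K :=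
  (continuousOn_const.inner (𝕜 := ℝ) (T.continuousOn_V.clm_apply continuousOn_const)).mul
    (continuousOn_const.inner (𝕜 := ℝ) continuousOn_id)

theorem _root_.IsTranslationChart.abs_inner_V_mul_le (u v w : Coord N) {x : Coord N}
    (hx : x ∈ K) : |⟪u, V x w⟫ * ⟪v, x⟫| ≤ B * R * ‖w‖ * (‖u‖ * ‖v‖) := by
  have hB := T.B_nonneg
  have h1 : |⟪u, V x w⟫| ≤ ‖u‖ * (B * ‖w‖) := (abs_real_inner_le_norm _ _).trans
    (mul_le_mul_of_nonneg_left (T.norm_V_apply_le hx w) (norm_nonneg u))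
  have h2 : |⟪v, x⟫| ≤ ‖v‖ * R := (abs_real_inner_le_norm _ _).trans
    (mul_le_mul_of_nonneg_left (T.norm_le x hx) (norm_nonneg v))
  rw [abs_mul]
  exact (mul_le_mul h1 h2 (abs_nonneg _) (by positivity)).trans_eq (by ring)

theorem _root_.IsTranslationChart.continuousOn_inner_h_mul {ε : Coord N} (hε : ‖ε‖ ≤ ρ) (u v : Coord N) :
    ContinuousOn (fun x => ⟪u, h ε x⟫ * ⟪v, h ε x⟫) K :=
  (continuousOn_const.inner (𝕜 := ℝ) (T.continuousOn ε hε)).mul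
    (continuousOn_const.inner (𝕜 := ℝ) (T.continuousOn ε hε))

include H

theorem abs_integral_inner_V_mul_sub_le (u v w : Coord N) :
    |∫ x, ⟪u, V x w⟫ * ⟪v, x⟫ ∂p -
        ∫ x in K, ⟪u, V x w⟫ * ⟪v, x⟫ ∂(multivariateGaussian 0 S)| ≤
      (4 * B * R + L * R + B) * ‖w‖ * (‖m‖ + η) * (‖u‖ * ‖v‖) := by
  have hB := T.B_nonneg
  have hL := T.L_nonneg
  have hR := T.R_nonneg
  refine (H.abs_integral_sub_setIntegral_le (b := B * R * ‖w‖ * (‖u‖ * ‖v‖))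
    (l := (L * R + B) * ‖w‖ * (‖u‖ * ‖v‖)) (by positivity) (by positivity)
    (fun x hx => T.abs_inner_V_mul_le u v w hx) fun x hx y hy => ?_).trans_eq (by ring)
  have h0 : ⟪u, V x w⟫ * ⟪v, x⟫ - ⟪u, V y w⟫ * ⟪v, y⟫ =
      ⟪u, (V x - V y) w⟫ * ⟪v, x⟫ + ⟪u, V y w⟫ * ⟪v, x - y⟫ := by
    rw [_root_.sub_apply, inner_sub_right, inner_sub_right]
    ring
  have h1 : |⟪u, (V x - V y) w⟫| ≤ ‖u‖ * (L * ‖x - y‖ * ‖w‖) :=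
    (abs_real_inner_le_norm _ _).trans (mul_le_mul_of_nonneg_left
      ((V x - V y).le_of_opNorm_le (T.norm_V_sub_le x hx y hy) w) (norm_nonneg u))
  have h2 : |⟪v, x⟫| ≤ ‖v‖ * R := (abs_real_inner_le_norm _ _).trans
    (mul_le_mul_of_nonneg_left (T.norm_le x hx) (norm_nonneg v))
  have h3 : |⟪u, V y w⟫| ≤ ‖u‖ * (B * ‖w‖) := (abs_real_inner_le_norm _ _).trans
    (mul_le_mul_of_nonneg_left (T.norm_V_apply_le hy w) (norm_nonneg u))
  have h4 := mul_le_mul h1 h2 (abs_nonneg _) (by positivity)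
  have h5 := mul_le_mul h3 (abs_real_inner_le_norm v (x - y)) (abs_nonneg _) (by positivity)
  rw [h0]
  refine (abs_add_le _ _).trans ?_
  rw [abs_mul, abs_mul]
  exact (add_le_add h4 h5).trans_eq (by ring)

/-- Replacing `ε` by `m'` and the posterior by the centred Gaussian in the first-order term of the
covariance. -/
theorem abs_integral_inner_V_mul_sub_setIntegral_le (u v ε m' : Coord N) :
    |∫ x, ⟪u, V x ε⟫ * ⟪v, x⟫ ∂p -
        ∫ x in K, ⟪u, V x m'⟫ * ⟪v, x⟫ ∂(multivariateGaussian 0 S)| ≤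
      (B * R * ‖ε - m'‖ + (4 * B * R + L * R + B) * ‖m'‖ * (‖m‖ + η)) * (‖u‖ * ‖v‖) := by
  have := H.isProbabilityMeasure
  have h1 : |∫ x, ⟪u, V x ε⟫ * ⟪v, x⟫ ∂p - ∫ x, ⟪u, V x m'⟫ * ⟪v, x⟫ ∂p| ≤
      B * R * ‖ε - m'‖ * (‖u‖ * ‖v‖) := by
    rw [← integral_sub (H.integrable_of_continuousOn (T.continuousOn_inner_V_mul u v ε))
      (H.integrable_of_continuousOn (T.continuousOn_inner_V_mul u v m'))]
    rw [← Real.norm_eq_abs]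
    refine norm_integral_le_of_ae_norm_le (H.ae_mem.mono fun x hx => ?_)
    have := T.abs_inner_V_mul_le u v (ε - m') hx
    rwa [map_sub, inner_sub_right, sub_mul, ← Real.norm_eq_abs] at this
  refine (abs_sub_le _ _ _).trans
    ((add_le_add h1 (H.abs_integral_inner_V_mul_sub_le T u v m')).trans_eq (by ring))

/-- The second-order expansion of the covariance in `ε`. -/
theorem abs_integral_inner_h_mul_sub_le {ε : Coord N} (hε : ‖ε‖ ≤ ρ) (hε1 : ‖ε‖ ≤ 1)
    (u v : Coord N) :
    |∫ x, ⟪u, h ε x⟫ * ⟪v, h ε x⟫ ∂p - (∫ x, ⟪u, x⟫ * ⟪v, x⟫ ∂p -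
        ∫ x, ⟪u, V x ε⟫ * ⟪v, x⟫ ∂p - ∫ x, ⟪v, V x ε⟫ * ⟪u, x⟫ ∂p)| ≤
      (2 * R * C + B ^ 2 + 2 * B * C + C ^ 2) * ‖ε‖ ^ 2 * (‖u‖ * ‖v‖) := by
  have := H.isProbabilityMeasure
  have i0 := H.integrable_of_continuousOn (T.continuousOn_inner_h_mul hε u v)
  have i1 : Integrable (fun x => ⟪u, x⟫ * ⟪v, x⟫) p := H.integrable_of_continuousOn
    (by fun_prop)
  have i2 := H.integrable_of_continuousOn (T.continuousOn_inner_V_mul u v ε)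
  have i3 := H.integrable_of_continuousOn (T.continuousOn_inner_V_mul v u ε)
  have i4 : Integrable (fun x => ⟪u, x⟫ * ⟪v, x⟫ - ⟪u, V x ε⟫ * ⟪v, x⟫) p := i1.sub i2
  have i5 : Integrable (fun x => ⟪u, x⟫ * ⟪v, x⟫ - ⟪u, V x ε⟫ * ⟪v, x⟫ - ⟪v, V x ε⟫ * ⟪u, x⟫) p :=
    i4.sub i3
  rw [← integral_sub i1 i2, ← integral_sub i4 i3, ← integral_sub i0 i5]
  rw [← Real.norm_eq_abs]
  refine norm_integral_le_of_ae_norm_le (H.ae_mem.mono fun x hx => ?_)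
  have hsplit : ∀ w : Coord N, ⟪w, h ε x⟫ = ⟪w, x⟫ - ⟪w, V x ε⟫ + ⟪w, h ε x - x + V x ε⟫ :=
    fun w => by simp only [inner_add_right, inner_sub_right]; ring
  have h1 : ∀ w : Coord N, |⟪w, x⟫| ≤ R * ‖w‖ := fun w =>
    (abs_real_inner_le_norm _ _).trans ((mul_le_mul_of_nonneg_left (T.norm_le x hx)
      (norm_nonneg w)).trans_eq (mul_comm _ _))
  have h2 : ∀ w : Coord N, |⟪w, V x ε⟫| ≤ B * ‖ε‖ * ‖w‖ := fun w =>
    (abs_real_inner_le_norm _ _).trans ((mul_le_mul_of_nonneg_left (T.norm_V_apply_le hx ε)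
      (norm_nonneg w)).trans_eq (mul_comm _ _))
  have h3 : ∀ w : Coord N, |⟪w, h ε x - x + V x ε⟫| ≤ C * ‖ε‖ ^ 2 * ‖w‖ := fun w =>
    (abs_real_inner_le_norm _ _).trans ((mul_le_mul_of_nonneg_left (T.norm_remainder_le hε hx)
      (norm_nonneg w)).trans_eq (mul_comm _ _))
  rw [Real.norm_eq_abs, hsplit u, hsplit v]
  exact abs_mul_sub_linearization_le T.R_nonneg T.B_nonneg T.C_nonneg (norm_nonneg ε) hε1
    (norm_nonneg u) (norm_nonneg v) (h1 u) (h2 u) (h3 u) (h1 v) (h2 v) (h3 v)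

/-- The covariance about `ε`, tested on `u` and `v`, when `ε` is close to `m'`. -/
theorem abs_covariance_sub_le {ε m' : Coord N} {c : ℝ} (hε : ‖ε‖ ≤ ρ) (hε1 : ‖ε‖ ≤ 1)
    (hη : η ≤ 1) (hm1 : ‖m'‖ ≤ 1) (hmm' : ‖m‖ ≤ 2 * ‖m'‖) (hεm : ‖ε‖ ≤ 4 * (‖m‖ + η))
    (hd : ‖ε - m'‖ ≤ c * (‖m'‖ ^ 2 + η)) (u v : Coord N) :
    |∫ x, ⟪u, h ε x⟫ * ⟪v, h ε x⟫ ∂p -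
        (⟪u, Matrix.toEuclideanCLM (n := Fin N) (𝕜 := ℝ) S v⟫ -
          ∫ x in K, ⟪u, V x m'⟫ * ⟪v, x⟫ ∂(multivariateGaussian 0 S) -
          ∫ x in K, ⟪v, V x m'⟫ * ⟪u, x⟫ ∂(multivariateGaussian 0 S))| ≤
      (128 * (2 * R * C + B ^ 2 + 2 * B * C + C ^ 2) + 5 +
        2 * (B * R * c + 2 * (4 * B * R + L * R + B))) * (‖m'‖ ^ 2 + η) * (‖u‖ * ‖v‖) := by
  have hη0 := H.nonneg
  have hB := T.B_nonneg
  have hL := T.L_nonneg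
  have hR := T.R_nonneg
  have hC := T.C_nonneg
  have h1 := H.abs_integral_inner_h_mul_sub_le T hε hε1 u v
  have h2 := H.abs_integral_inner_mul_inner_sub_le u v
  have h3 := H.abs_integral_inner_V_mul_sub_setIntegral_le T u v ε m'
  have h4 := H.abs_integral_inner_V_mul_sub_setIntegral_le T v u ε m'
  rw [mul_comm ‖v‖ ‖u‖] at h4
  have hUW : 0 ≤ ‖u‖ * ‖v‖ := by positivity
  have h5 : |⟪u, m⟫ * ⟪v, m⟫| ≤ ‖m‖ ^ 2 * (‖u‖ * ‖v‖) := by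
    rw [abs_mul]
    exact (mul_le_mul (abs_real_inner_le_norm u m) (abs_real_inner_le_norm v m)
      (abs_nonneg _) (by positivity)).trans_eq (by ring)
  -- each error term is bounded by a multiple of `‖m'‖ ^ 2 + η`
  have e1 : ‖ε‖ ^ 2 ≤ 128 * (‖m'‖ ^ 2 + η) := by
    have := pow_le_pow_left₀ (norm_nonneg ε)
      (hεm.trans (by linarith : 4 * (‖m‖ + η) ≤ 4 * (2 * ‖m'‖ + η))) 2
    nlinarith [sq_nonneg (2 * ‖m'‖ - η)]
  have e2 : ‖m‖ ^ 2 ≤ 4 * (‖m'‖ ^ 2 + η) := by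
    have := pow_le_pow_left₀ (norm_nonneg m) hmm' 2
    nlinarith
  have e3 : ‖m'‖ * (‖m‖ + η) ≤ 2 * (‖m'‖ ^ 2 + η) := by
    nlinarith [norm_nonneg m']
  have e4 : η ≤ ‖m'‖ ^ 2 + η := by nlinarith [sq_nonneg ‖m'‖]
  set D := ‖m'‖ ^ 2 + η
  have f1 : (2 * R * C + B ^ 2 + 2 * B * C + C ^ 2) * ‖ε‖ ^ 2 * (‖u‖ * ‖v‖) ≤
      (2 * R * C + B ^ 2 + 2 * B * C + C ^ 2) * (128 * D) * (‖u‖ * ‖v‖) := by gcongr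
  have f2 : ‖u‖ * ‖v‖ * η ≤ D * (‖u‖ * ‖v‖) := by nlinarith
  have f3 : (B * R * ‖ε - m'‖ + (4 * B * R + L * R + B) * ‖m'‖ * (‖m‖ + η)) * (‖u‖ * ‖v‖) ≤
      (B * R * (c * D) + (4 * B * R + L * R + B) * (2 * D)) * (‖u‖ * ‖v‖) := by
    rw [mul_assoc (4 * B * R + L * R + B)]
    gcongr
  have f5 : ‖m‖ ^ 2 * (‖u‖ * ‖v‖) ≤ 4 * D * (‖u‖ * ‖v‖) := by gcongr
  rw [abs_le] at *
  constructor <;> linarith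

end IsNearGaussian

/-! ### Matrices of integrals -/

theorem dotProduct_integral_mulVec {α : Type*} [MeasurableSpace α] {μ : Measure α} {a b : ℕ}
    {W : α → Matrix (Fin a) (Fin b) ℝ} (hW : ∀ i j, Integrable (fun x => W x i j) μ)
    (u : Fin a → ℝ) (v : Fin b → ℝ) :
    u ⬝ᵥ (Matrix.of fun i j => ∫ x, W x i j ∂μ) *ᵥ v = ∫ x, u ⬝ᵥ W x *ᵥ v ∂μ := by
  have hi : ∀ i, Integrable (fun x => ∑ j, W x i j * v j) μ := fun i =>
    integrable_finsetSum _ fun j _ => (hW i j).mul_const _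
  simp only [dotProduct, mulVec, Matrix.of_apply]
  rw [integral_finsetSum _ fun i _ => (hi i).const_mul _]
  refine Finset.sum_congr rfl fun i _ => ?_
  rw [integral_const_mul, integral_finsetSum _ fun j _ => (hW i j).mul_const _]
  simp_rw [integral_mul_const]

theorem dotProduct_integral_mul_mulVec {α : Type*} [MeasurableSpace α] {μ : Measure α} {a b : ℕ}
    {f : α → Fin a → ℝ} {g : α → Fin b → ℝ}
    (hfg : ∀ i j, Integrable (fun x => f x i * g x j) μ) (u : Fin a → ℝ) (v : Fin b → ℝ) :
    u ⬝ᵥ (Matrix.of fun i j => ∫ x, f x i * g x j ∂μ) *ᵥ v =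
      ∫ x, (u ⬝ᵥ f x) * (v ⬝ᵥ g x) ∂μ := by
  refine (dotProduct_integral_mulVec (W := fun x => vecMulVec (f x) (g x)) hfg u v).trans ?_
  refine integral_congr_ae (Filter.Eventually.of_forall fun x => ?_)
  simp only [dotProduct, mulVec, vecMulVec_apply]
  rw [Finset.sum_mul]
  refine Finset.sum_congr rfl fun i _ => ?_
  rw [Finset.mul_sum, Finset.mul_sum]
  exact Finset.sum_congr rfl fun j _ => by ring

theorem integral_mul_self_sub_add_nonneg {α : Type*} [MeasurableSpace α] {μ : Measure α}
    {f g : α → ℝ} (hf : MemLp f 2 μ) (hg : MemLp g 2 μ) :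
    0 ≤ ∫ x, f x * f x ∂μ - 2 * ∫ x, f x * g x ∂μ + ∫ x, g x * g x ∂μ := by
  have i1 : Integrable (fun x => f x * f x) μ := hf.integrable_mul hf
  have i2 : Integrable (fun x => 2 * (f x * g x)) μ := (hf.integrable_mul hg).const_mul 2
  have i3 : Integrable (fun x => g x * g x) μ := hg.integrable_mul hg
  have i4 : Integrable (fun x => f x * f x - 2 * (f x * g x)) μ := i1.sub i2
  rw [← integral_const_mul, ← integral_sub i1 i2, ← integral_add i4 i3]
  refine integral_nonneg fun x => ?_
  dsimp only [Pi.zero_apply]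
  nlinarith [sq_nonneg (f x - g x)]

theorem real_inner_eq_dotProduct {N : ℕ} (u x : Coord N) : inner ℝ u x = u.ofLp ⬝ᵥ x.ofLp := by
  rw [EuclideanSpace.inner_eq_star_dotProduct, dotProduct_comm]
  simp

namespace MatrixLieGroup

open scoped RealInnerProductSpace

variable {n N : ℕ} {G : MatrixLieGroup n N} {K : Set (Coord N)} {p : Measure (Coord N)}
  {m : Coord N} {S : Matrix (Fin N) (Fin N) ℝ} {η : ℝ} (H : IsNearGaussian K p m S η)
  {h : Coord N → Coord N → Coord N} {ρ R B L C : ℝ}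
  (T : IsTranslationChart K G.jlInv h ρ R B L C)
include H T

theorem toEuclideanCLM_avgJlInv :
    Matrix.toEuclideanCLM (n := Fin N) (𝕜 := ℝ) (G.avgJlInv K S) =
      ∫ x in K, G.jlInv x ∂(multivariateGaussian 0 S) := by
  refine ContinuousLinearMap.ext fun v => ext_inner_left ℝ fun u => ?_
  rw [H.inner_setIntegral_apply T.continuousOn_V, Matrix.inner_toEuclideanCLM, avgJlInv,
    dotProduct_integral_mulVec fun i j => ?_]
  · simp_rw [jlInv, Matrix.inner_toEuclideanCLM]
  · have hc : ContinuousOn (fun x => G.jlInv x (EuclideanSpace.single j 1) i) K :=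
      (EuclideanSpace.proj (𝕜 := ℝ) i).continuous.comp_continuousOn
        (T.continuousOn_V.clm_apply continuousOn_const)
    refine Integrable.congr (hc.integrableOn_compact H.isCompact)
      (Filter.Eventually.of_forall fun x => ?_)
    simp [jlInv]

theorem inner_avgJlInvMul (u v w : Coord N) :
    ⟪u, Matrix.toEuclideanCLM (n := Fin N) (𝕜 := ℝ) (G.avgJlInvMul K S w) v⟫ =
      ∫ x in K, ⟪u, G.jlInv x w⟫ * ⟪v, x⟫ ∂(multivariateGaussian 0 S) := by
  rw [Matrix.inner_toEuclideanCLM, avgJlInvMul,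
    dotProduct_integral_mul_mulVec (g := fun x => WithLp.ofLp x) fun i j => ?_]
  · simp_rw [real_inner_eq_dotProduct, jlInv, Matrix.ofLp_toEuclideanCLM]
  · have hc := T.continuousOn_inner_V_mul (EuclideanSpace.single i 1) (EuclideanSpace.single j 1) w
    refine Integrable.congr (hc.integrableOn_compact H.isCompact)
      (Filter.Eventually.of_forall fun x => ?_)
    simp [jlInv, EuclideanSpace.inner_single_left]

theorem inner_groupCov {D : Set (Coord N)} {μ : G.carrier} {ε : Coord N} (hε : ‖ε‖ ≤ ρ)
    (hh : ∀ x, G.log D ((μ * G.exp ε)⁻¹ * (μ * G.exp x)) = h ε x) (u v : Coord N) :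
    ⟪u, Matrix.toEuclideanCLM (n := Fin N) (𝕜 := ℝ)
      (G.groupCov D μ p (μ * G.exp ε)) v⟫ = ∫ x, ⟪u, h ε x⟫ * ⟪v, h ε x⟫ ∂p := by
  simp_rw [Matrix.inner_toEuclideanCLM, groupCov, hh]
  rw [dotProduct_integral_mul_mulVec fun i j => ?_]
  · simp_rw [real_inner_eq_dotProduct]
  · have hc := T.continuousOn_inner_h_mul hε (EuclideanSpace.single i 1)
      (EuclideanSpace.single j 1)
    refine Integrable.congr (H.integrable_of_continuousOn hc)
      (Filter.Eventually.of_forall fun x => ?_)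
    simp [EuclideanSpace.inner_single_left]

end MatrixLieGroup

/-! ### The posterior of the fusion problem -/

namespace FusionProblem

open scoped RealInnerProductSpace

variable {n₁ N n₂ M : ℕ} {G₁ : MatrixLieGroup n₁ N} {G₂ : MatrixLieGroup n₂ M}
  {F : FusionProblem G₁ G₂} {K : Set (Coord N)} (hF : F.WellPosed K)
include hF

/-- `Σ` is the covariance of `x - K_g (k̃ - m̃)`. Semidefiniteness is needed for `N(m, Σ)` to have
covariance `Σ`: `multivariateGaussian` is a Dirac mass for other matrices. -/
theorem cov_posSemidef : F.cov.PosSemidef := by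
  have : IsProbabilityMeasure F.joint := by unfold joint; infer_instance
  have hS : F.S.IsHermitian := by
    ext i j
    simp [S, mul_comm]
  have hGS : F.gain * F.S = F.C := by
    rw [gain, Matrix.mul_assoc, Matrix.nonsing_inv_mul _ hF.isUnit_S, Matrix.mul_one]
  refine Matrix.PosSemidef.of_dotProduct_mulVec_nonneg ?_ fun v => ?_
  · refine F.P_posSemidef.isHermitian.sub ?_
    have := Matrix.isHermitian_mul_mul_conjTranspose F.gain hS
    rwa [conjTranspose_eq_transpose_of_trivial] at this
  set w : Fin M → ℝ := F.gainᵀ *ᵥ v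
  have hk : MemLp (fun z => F.kTilde z - F.mTilde) 2 F.joint := hF.memLp.sub (memLp_const _)
  have hx : MemLp (fun z : Coord N × Coord M => z.1) 2 F.joint :=
    IsGaussian.memLp_two_id.comp_measurePreserving measurePreserving_fst
  have hki : ∀ i, MemLp (fun z => (F.kTilde z - F.mTilde) i) 2 F.joint := fun i =>
    (EuclideanSpace.proj (𝕜 := ℝ) i).comp_memLp' hk
  have hxi : ∀ i, MemLp (fun z : Coord N × Coord M => z.1 i) 2 F.joint := fun i =>
    (EuclideanSpace.proj (𝕜 := ℝ) i).comp_memLp' hx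
  have hvx : MemLp (fun z : Coord N × Coord M => v ⬝ᵥ z.1.ofLp) 2 F.joint :=
    memLp_finsetSum _ fun i _ => (hxi i).const_mul (v i)
  have hwk : MemLp (fun z => w ⬝ᵥ (F.kTilde z - F.mTilde).ofLp) 2 F.joint :=
    memLp_finsetSum _ fun i _ => (hki i).const_mul (w i)
  have eP : v ⬝ᵥ F.P *ᵥ v = ∫ z, (v ⬝ᵥ z.1.ofLp) * (v ⬝ᵥ z.1.ofLp) ∂F.joint := by
    have h1 := integral_inner_mul_inner_multivariateGaussian (m := 0) F.P_posSemidef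
      (WithLp.toLp 2 v) (WithLp.toLp 2 v)
    rw [Matrix.inner_toEuclideanCLM, inner_zero_right, mul_zero, add_zero] at h1
    simp_rw [real_inner_eq_dotProduct] at h1
    rw [← h1, joint, integral_fun_fst (fun x : Coord N => (v ⬝ᵥ x.ofLp) * (v ⬝ᵥ x.ofLp))]
    simp
  have eS : w ⬝ᵥ F.S *ᵥ w = ∫ z, (w ⬝ᵥ (F.kTilde z - F.mTilde).ofLp) *
      (w ⬝ᵥ (F.kTilde z - F.mTilde).ofLp) ∂F.joint :=
    dotProduct_integral_mul_mulVec (fun i j => MemLp.integrable_mul (hki i) (hki j)) w w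
  have eC : v ⬝ᵥ F.C *ᵥ w = ∫ z, (v ⬝ᵥ z.1.ofLp) *
      (w ⬝ᵥ (F.kTilde z - F.mTilde).ofLp) ∂F.joint :=
    dotProduct_integral_mul_mulVec (f := fun z : Coord N × Coord M => z.1.ofLp)
      (fun i j => MemLp.integrable_mul (hxi i) (hki j)) v w
  have eCS : v ⬝ᵥ F.C *ᵥ w = w ⬝ᵥ F.S *ᵥ w := by
    rw [← hGS, ← Matrix.mulVec_mulVec, Matrix.dotProduct_mulVec v, ← Matrix.mulVec_transpose]
  have ecov : v ⬝ᵥ F.cov *ᵥ v = v ⬝ᵥ F.P *ᵥ v - w ⬝ᵥ F.S *ᵥ w := by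
    rw [cov, Matrix.sub_mulVec, dotProduct_sub, ← Matrix.mulVec_mulVec, ← Matrix.mulVec_mulVec,
      Matrix.dotProduct_mulVec v F.gain, ← Matrix.mulVec_transpose]
  have key := integral_mul_self_sub_add_nonneg hvx hwk
  rw [← eP, ← eC, ← eS, eCS] at key
  rw [star_trivial, ecov]
  linarith

theorem isProbabilityMeasure_posterior : IsProbabilityMeasure (F.posterior K) := by
  refine ⟨?_⟩
  rw [posterior, Measure.smul_apply, withDensity_apply _ MeasurableSet.univ,
    Measure.restrict_univ, smul_eq_mul]
  exact ENNReal.inv_mul_cancel hF.evidence_ne_zero hF.evidence_ne_top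

/-- The posterior and the output of the Gaussian filter, when their distance is finite. -/
theorem isNearGaussian_posterior (hK : IsCompact K) (hconv : Convex ℝ K)
    (hsymm : ∀ x ∈ K, -x ∈ K) (hη : F.gaussError K ≠ ∞) :
    IsNearGaussian K (F.posterior K) F.m F.cov (F.gaussError K).toReal where
  isProbabilityMeasure := isProbabilityMeasure_posterior hF
  ae_mem := by
    have hac : F.posterior K ≪ (multivariateGaussian 0 F.P).restrict K :=
      Measure.smul_absolutelyContinuous.trans (withDensity_absolutelyContinuous _ _)
    exact hac.ae_le (ae_restrict_mem hK.measurableSet)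
  posSemidef := cov_posSemidef hF
  isCompact := hK
  convex := hconv
  neg_mem := hsymm
  abs_integral_sub_le f hf hb := by
    rw [← ENNReal.ofReal_le_iff_le_toReal hη]
    exact le_iSup (fun f : {f : Coord N → ℝ // Measurable f ∧ ∀ x, |f x| ≤ 1 + ‖x‖ ^ 2} =>
      ENNReal.ofReal |∫ x, f.1 x ∂(F.posterior K) - ∫ x, f.1 x ∂(multivariateGaussian F.m F.cov)|)
      ⟨f, hf, hb⟩

end FusionProblem

/-! ### The fused mean and covariance -/

theorem Matrix.isUnit_det_of_norm_toEuclideanCLM_sub_one_lt {N : ℕ}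
    {A : Matrix (Fin N) (Fin N) ℝ}
    (hA : ‖Matrix.toEuclideanCLM (n := Fin N) (𝕜 := ℝ) A - 1‖ < 1) : IsUnit A.det := by
  rw [← Matrix.isUnit_iff_isUnit_det]
  rw [norm_sub_rev] at hA
  have h := isUnit_one_sub_of_norm_lt_one hA
  rw [sub_sub_cancel] at h
  exact (isUnit_map_iff (Matrix.toEuclideanCLM (n := Fin N) (𝕜 := ℝ)) A).1 h

theorem mainTheorem6 {n₁ N : ℕ} (G₁ : MatrixLieGroup n₁ N) (D : Set (Coord N))
    (hD : G₁.IsExpDomain D) (K : Set (Coord N)) (hKD : K ⊆ D) (hKcompact : IsCompact K)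
    (hKconvex : Convex ℝ K) (hKsymm : ∀ x ∈ K, -x ∈ K) :
    ∃ c δ ρ : ℝ, 0 < c ∧ 0 < δ ∧ 0 < ρ ∧
      ∀ (n₂ M : ℕ) (G₂ : MatrixLieGroup n₂ M) (F : FusionProblem G₁ G₂),
        F.WellPosed K → ‖F.m‖ ≤ δ → spectralNorm₂ F.cov ≤ δ →
        F.gaussError K ≤ ENNReal.ofReal δ →
        IsUnit (G₁.avgJlInv K F.cov).det ∧
        ∃ ε : Coord N, ‖ε‖ ≤ ρ ∧
          G₁.IsGroupMean D F.μ (F.posterior K) (F.μ * G₁.exp ε) ∧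
          (∀ ε' : Coord N, ‖ε'‖ ≤ ρ →
            G₁.IsGroupMean D F.μ (F.posterior K) (F.μ * G₁.exp ε') → ε' = ε) ∧
          ‖ε - G₁.corrected K F.cov F.m‖ ≤
            c * (‖G₁.corrected K F.cov F.m‖ ^ 2 + (F.gaussError K).toReal) ∧
          spectralNorm₂
              (G₁.groupCov D F.μ (F.posterior K) (F.μ * G₁.exp ε) -
                (F.cov - symPart
                  (G₁.avgJlInvMul K F.cov (G₁.corrected K F.cov F.m)))) ≤
            c * (‖G₁.corrected K F.cov F.m‖ ^ 2 + (F.gaussError K).toReal) := by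
  obtain ⟨ρ₀, R, B, L, C, T, hT⟩ := MatrixLieGroup.exists_isTranslationChart hD hKcompact hKD
  have hρ₀ := T.pos
  have hR := T.R_nonneg
  have hB := T.B_nonneg
  have hL := T.L_nonneg
  have hC := T.C_nonneg
  set c₁ : ℝ := 2 * (1 + 128 * C + 32 * (4 * B + L)) with hc₁
  set c₂ : ℝ := 128 * (2 * R * C + B ^ 2 + 2 * B * C + C ^ 2) + 5 +
    2 * (B * R * c₁ + 2 * (4 * B * R + L * R + B)) with hc₂
  -- `C * s ≤ 1 / 4` makes the map `ε ↦ ε + ∫ h(ε, x) dp` a contraction of the ball of radius `s`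
  set s : ℝ := min (min ρ₀ 1) (1 / (4 * (C + 1))) with hs
  have hs0 : 0 < s := by positivity
  have hsρ : s ≤ ρ₀ := (min_le_left _ _).trans (min_le_left _ _)
  have hs1 : s ≤ 1 := (min_le_left _ _).trans (min_le_right _ _)
  have hCs : C * s ≤ 1 / 4 := by
    have h1 : s * (4 * (C + 1)) ≤ 1 := (le_div_iff₀ (by positivity)).1 (min_le_right _ _)
    nlinarith
  -- the bounds on `δ` leave room for the contraction in the ball of radius `s`, and keep the averages
  -- of `J_l⁻¹` close to `1`
  set δ : ℝ := min (min (s / 8) (1 / 32)) (min (1 / (64 * (L ^ 2 * N + 1)))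
    (1 / (8 * (4 * B + L + 1)))) with hδ
  have hδ0 : 0 < δ := by positivity
  have hδs : δ ≤ s / 8 := (min_le_left _ _).trans (min_le_left _ _)
  have hδ1 : δ ≤ 1 / 32 := (min_le_left _ _).trans (min_le_right _ _)
  have hδL : 4 * L ^ 2 * (N * δ) ≤ 1 / 16 := by
    have h1 : δ * (64 * (L ^ 2 * N + 1)) ≤ 1 :=
      (le_div_iff₀ (by positivity)).1 ((min_le_right _ _).trans (min_le_left _ _))
    nlinarith
  have hδB : (4 * B + L) * (δ + δ) ≤ 1 / 4 := by
    have h1 : δ * (8 * (4 * B + L + 1)) ≤ 1 :=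
      (le_div_iff₀ (by positivity)).1 ((min_le_right _ _).trans (min_le_right _ _))
    nlinarith
  refine ⟨c₁ + c₂, δ, s, by positivity, hδ0, hs0, fun n₂ M G₂ F hF hm hcov hgerr => ?_⟩
  have H := F.isNearGaussian_posterior hF hKcompact hKconvex hKsymm
    (ne_top_of_le_ne_top ENNReal.ofReal_ne_top hgerr)
  have hη : (F.gaussError K).toReal ≤ δ := ENNReal.toReal_le_of_le_ofReal hδ0.le hgerr
  set η := (F.gaussError K).toReal
  have hη0 := H.nonneg
  have hA := MatrixLieGroup.toEuclideanCLM_avgJlInv H T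
  have hV₀ : ‖∫ x in K, G₁.jlInv x ∂(multivariateGaussian 0 F.cov) - 1‖ ≤ 1 / 4 := by
    have h1 := H.norm_setIntegral_V_sub_one_le T
    have h2 : 4 * L ^ 2 * (N * spectralNorm₂ F.cov) ≤ 4 * L ^ 2 * (N * δ) := by gcongr
    linarith
  have hV : ‖∫ x, G₁.jlInv x ∂(F.posterior K) - 1‖ ≤ 1 / 2 := by
    have h1 := H.norm_integral_V_sub_le T
    have h2 : (4 * B + L) * (‖F.m‖ + η) ≤ (4 * B + L) * (δ + δ) := by gcongr
    have h3 := norm_sub_le_norm_sub_add_norm_sub (∫ x, G₁.jlInv x ∂(F.posterior K))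
      (∫ x in K, G₁.jlInv x ∂(multivariateGaussian 0 F.cov)) 1
    linarith
  have hdet : IsUnit (G₁.avgJlInv K F.cov).det :=
    Matrix.isUnit_det_of_norm_toEuclideanCLM_sub_one_lt (by rw [hA]; linarith)
  refine ⟨hdet, ?_⟩
  set m' := G₁.corrected K F.cov F.m with hm'
  have hAm : (∫ x in K, G₁.jlInv x ∂(multivariateGaussian 0 F.cov)) m' = F.m := by
    rw [← hA, hm', MatrixLieGroup.corrected, Matrix.toEuclideanCLM_toLp, Matrix.mulVec_mulVec,
      Matrix.mul_nonsing_inv _ hdet, Matrix.one_mulVec]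
  have hmm : ‖F.m - m'‖ ≤ 1 / 4 * ‖m'‖ := by
    have := (∫ x in K, G₁.jlInv x ∂(multivariateGaussian 0 F.cov) - 1).le_of_opNorm_le hV₀ m'
    rwa [_root_.sub_apply, one_apply_eq_self, hAm] at this
  have hm2 : ‖F.m‖ ≤ 2 * ‖m'‖ := by
    have := norm_le_norm_add_norm_sub m' F.m
    linarith [norm_nonneg m', norm_sub_rev F.m m']
  have hm1 : ‖m'‖ ≤ 1 := by
    have := norm_le_norm_add_norm_sub F.m m'
    linarith [norm_nonneg m', norm_sub_rev F.m m']
  have hlog : ∀ ε x, G₁.log D ((F.μ * G₁.exp ε)⁻¹ * (F.μ * G₁.exp x)) =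
      G₁.log D ((G₁.exp ε)⁻¹ * G₁.exp x) := fun ε x => by congr 1; group
  obtain ⟨ε, hε, h0⟩ := H.exists_integral_eq_zero T hs0.le hsρ hCs hV (by linarith)
  have hd := H.norm_sub_corrected_le T hsρ hCs hV (hV₀.trans (by norm_num))
    (by linarith) hAm hm2 hε h0
  have hεm := H.norm_le_of_integral_eq_zero T hsρ hCs hV hε h0
  have hcc : 0 ≤ c₁ ∧ 0 ≤ c₂ := ⟨by positivity, by positivity⟩
  have hη2 : 0 ≤ ‖m'‖ ^ 2 + η := by positivity
  refine ⟨ε, hε, ⟨?_, ?_, ?_⟩, fun ε' hε' hmean => ?_, ?_, ?_⟩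
  · filter_upwards [H.ae_mem] with x hx
    have := hT ε (hε.trans hsρ) x hx
    rwa [show (F.μ * G₁.exp ε)⁻¹ * (F.μ * G₁.exp x) = (G₁.exp ε)⁻¹ * G₁.exp x by group]
  · simp_rw [hlog]
    exact H.integrable_of_continuousOn (T.continuousOn ε (hε.trans hsρ))
  · simp_rw [hlog]
    exact h0
  · have h1 := hmean.2.2
    simp_rw [hlog] at h1
    exact H.eq_of_integral_eq_zero T hsρ hCs hV hε hε' h0 h1
  · exact hd.trans (mul_le_mul_of_nonneg_right (by linarith [hcc.2]) hη2)
  · refine (opNorm_le_of_abs_inner_le (c := c₂ * (‖m'‖ ^ 2 + η)) (mul_nonneg hcc.2 hη2)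
      fun u v => ?_).trans (mul_le_mul_of_nonneg_right (by linarith [hcc.1]) hη2)
    have h1 := H.abs_covariance_sub_le T (hε.trans hsρ) (hε.trans hs1) (by linarith) hm1 hm2
      hεm hd u v
    rw [← MatrixLieGroup.inner_groupCov H T (μ := F.μ) (hε.trans hsρ) (hlog ε),
      ← MatrixLieGroup.inner_avgJlInvMul H T, ← MatrixLieGroup.inner_avgJlInvMul H T] at h1
    have h2 : ∀ A : Matrix (Fin N) (Fin N) ℝ,
        inner ℝ u (Matrix.toEuclideanCLM (n := Fin N) (𝕜 := ℝ) Aᵀ v) =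
          inner ℝ v (Matrix.toEuclideanCLM (n := Fin N) (𝕜 := ℝ) A u) := fun A => by
      rw [Matrix.inner_toEuclideanCLM, Matrix.inner_toEuclideanCLM, Matrix.mulVec_transpose,
        dotProduct_comm, ← Matrix.dotProduct_mulVec]
    rw [symPart, map_sub, map_sub, map_add, _root_.sub_apply, _root_.sub_apply,
      _root_.add_apply, inner_sub_right, inner_sub_right, inner_add_right, h2, ← sub_sub]
    exact h1
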